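/- Let $d\ge 2$, let $\Lambda\subset\mathbb R^d$ be a lattice and $\mathbb T^d=\mathbb R^d/\Lambda$ the flat torus. Let $\mathcal R_1,\dots,\mathcal R_K\subset\mathbb T^d$ be scatterers: each $\mathcal R_i$ is the projection of the boundary $\{R_i=0\}$ of a compact convex body $\{R_i\le 0\}\subset\mathbb R^d$, where $R_i\in C^{8d-7}(\mathbb R^d)$ has non-vanishing gradient on $\{R_i=0\}$ and the second fundamental form of $\{R_i=0\}$ is positive definite at every point; the bodies $\{R_i\le0\}$ embed in $\mathbb T^d$ and their images there are pairwise disjoint. Let $Q\subset\mathbb T^d$ be the complement of the interiors of the bodies, so that $\partial Q=\bigcup_i\mathcal R_i$, let $n(q)$ be the unit normal to $\partial Q$ at $q$ directed into $Q$, and set $$\partial M=\{(q,v): q\in\partial Q,\ v\in S^{d-1},\ (v,n(q))\ge 0\},\qquad \mathcal S=\{(q,v)\in\partial M: (v,n(q))=0\}.$$ The billiard map $T:\partial M\to\partial M$ sends $(q,v)$ to $(q',v')$, where $q'$ is the first point of $\partial Q$ met by the ray $q+tv$, $t>0$ (transversally or tangentially), and $v'=v-2(v,n(q'))\,n(q')$.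 For $k\ge 0$ put $T^{-k}\mathcal S=\{x\in\partial M: T^kx\in\mathcal S\}$. Assume: 1. (finite horizon) the time between two successive collisions is uniformly bounded above; 2. the time between two successive collisions is bounded below by some constant $\tau_0>0$; 3. no trajectory of $T$ has more than $2d-2$ tangencies, i.e. visits $\mathcal S$ more than $2d-2$ times. Let $x_0\in\partial M\setminus\mathcal S$. Then there is a neighborhood $U$ of $x_0$, open in $\partial M$ and contained in $\partial M\setminus\mathcal S$, such that for every integer $k\ge 0$ there are constants $C$ and $\delta_0>0$ such that for every connected component $Y$ of $T^{-k}\mathcal S\cap U$ and every $0<\delta<\delta_0$, the $\delta$-neighborhood $Y^{[\delta]}$ of $Y$ in $\partial M$ satisfies $$\int_{Y^{[\delta]}}dq\,dv\le C\delta\qquad\text{and}\qquad \mu_1\bigl(Y^{[\delta]}\bigr)\le C\delta ,$$ where $dq\,dv$ is the product of the surface measures on $\partial Q$ and $S^{d-1}$, and $d\mu_1=|(v,n(q))|\,dq\,dv$ is the (unnormalized) $T$-invariant measure. -/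

import Mathlib

open MeasureTheory Metric Set
open scoped RealInnerProductSpace

noncomputable section

namespace DispersingBilliard

/-- The Euclidean space `ℝ^d`, universal cover of the torus. -/
abbrev Space (d : ℕ) : Type := EuclideanSpace ℝ (Fin d)

/-- The flat torus `ℝ^d / Λ`, with the quotient (flat) distance. -/
abbrev Torus {d : ℕ} (Λ : Submodule ℤ (Space d)) : Type := Space d ⧸ Λ.toAddSubgroup

/-- Positions on the torus together with unit velocities: `𝕋^d × S^{d-1}`. -/
abbrev Phase {d : ℕ} (Λ : Submodule ℤ (Space d)) : Type :=
  Torus Λ × sphere (0 : Space d) 1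

/-- Finitely many strictly convex scatterers of class `C^{8d-7}` on the torus `ℝ^d / Λ`.
The `i`-th scatterer is given by the choice of one lift to `ℝ^d`, which is the zero level set of
`R i`; all other lifts are the shifts by elements of `Λ`. -/
structure Scatterers {d : ℕ} (Λ : Submodule ℤ (Space d)) (K : ℕ) where
  /-- the defining functions -/
  R : Fin K → Space d → ℝ
  contDiff : ∀ i, ContDiff ℝ ((8 * d - 7 : ℕ) : WithTop ℕ∞) (R i)
  /-- `{R i ≤ 0}` is a nonempty compact convex body ... -/
  nonempty : ∀ i, {z | R i z ≤ 0}.Nonempty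
  isCompact : ∀ i, IsCompact {z | R i z ≤ 0}
  convex : ∀ i, Convex ℝ {z | R i z ≤ 0}
  /-- ... whose boundary `{R i = 0}` is a regular hypersurface ... -/
  gradient_ne_zero : ∀ i z, R i z = 0 → gradient (R i) z ≠ 0
  /-- ... with positive definite second fundamental form: the second derivative of `R i` is
  positive definite on the tangent space. -/
  curvature_pos : ∀ i z, R i z = 0 → ∀ w : Space d, w ≠ 0 → ⟪gradient (R i) z, w⟫ = 0 →
    0 < fderiv ℝ (fderiv ℝ (R i)) z w w
  /-- The bodies are embedded in the torus and pairwise disjoint there (no multiple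
  collisions). -/
  disjoint : ∀ i j z w, R i z ≤ 0 → R j w ≤ 0 → z - w ∈ Λ → i = j ∧ z = w

namespace Scatterers

variable {d K : ℕ} {Λ : Submodule ℤ (Space d)} (B : Scatterers Λ K)

/-- The boundary `∂Q` of the billiard domain: the union of the scatterers on the torus.
The domain `Q` itself is the part of the torus not covered by the sets `{R i < 0}`. -/
def boundary : Set (Torus Λ) := {q | ∃ i z, B.R i z = 0 ∧ (z : Torus Λ) = q}

open Classical in
/-- The unit normal `n(q)` to `∂Q` at `q ∈ ∂Q`, directed into the domain `Q`, i.e. out of the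
scatterer (zero at points outside `∂Q`). -/
def normal (q : Torus Λ) : Space d :=
  if h : ∃ p : Fin K × Space d, B.R p.1 p.2 = 0 ∧ (p.2 : Torus Λ) = q then
    ‖gradient (B.R h.choose.1) h.choose.2‖⁻¹ • gradient (B.R h.choose.1) h.choose.2
  else 0

/-- The normal does not depend on choices. -/
theorem normal_coe {i : Fin K} {z : Space d} (hz : B.R i z = 0) :
    B.normal (z : Torus Λ) = ‖gradient (B.R i) z‖⁻¹ • gradient (B.R i) z := by
  have h : ∃ p : Fin K × Space d, B.R p.1 p.2 = 0 ∧ (p.2 : Torus Λ) = (z : Torus Λ) :=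
    ⟨(i, z), hz, rfl⟩
  have hs := h.choose_spec
  have hm : h.choose.2 - z ∈ Λ := by
    have := (QuotientAddGroup.eq (s := Λ.toAddSubgroup)).1 hs.2.symm
    rw [sub_eq_neg_add]
    exact this
  obtain ⟨h1, h2⟩ := B.disjoint _ _ _ _ hs.1.le hz.le hm
  rw [normal, dif_pos h, h1, h2]

/-- The phase space `∂M = {(q, v) : q ∈ ∂Q, (v, n(q)) ≥ 0}` of the billiard map. -/
def bdryM : Set (Phase Λ) :=
  {x | x.1 ∈ B.boundary ∧ 0 ≤ ⟪(x.2 : Space d), B.normal x.1⟫}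

/-- The set `S` of tangential reflections. -/
def tangential : Set (Phase Λ) :=
  {x | x ∈ B.bdryM ∧ ⟪(x.2 : Space d), B.normal x.1⟫ = 0}

/-- The positive times at which the straight line issued from `x` meets `∂Q`
(transversally or tangentially). -/
def hitTimes (x : Phase Λ) : Set ℝ :=
  {t | 0 < t ∧ x.1 + ((t • (x.2 : Space d) : Space d) : Torus Λ) ∈ B.boundary}

/-- The point of `∂Q` at which the straight line issued from `x` first meets `∂Q`. -/
def nextPoint (x : Phase Λ) : Torus Λ :=
  x.1 + ((sInf (B.hitTimes x) • (x.2 : Space d) : Space d) : Torus Λ)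

/-- Elastic reflection of the velocity `v` at `q ∈ ∂Q`: `v ↦ v - 2 (v, n(q)) n(q)`. -/
def reflect (q : Torus Λ) (v : sphere (0 : Space d) 1) : sphere (0 : Space d) 1 :=
  ⟨(Submodule.span ℝ {B.normal q})ᗮ.reflection (v : Space d), by simp⟩

/-- The billiard map: free flight up to the next collision with `∂Q` (tangential collisions
included), followed by the elastic reflection. -/
def billiardMap (x : Phase Λ) : Phase Λ :=
  (B.nextPoint x, B.reflect (B.nextPoint x) x.2)

/-- The singularity set `T^{-k} S`. -/
def singular (k : ℕ) : Set (Phase Λ) :=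
  {x | x ∈ B.bdryM ∧ B.billiardMap^[k] x ∈ B.tangential}

/-- Finite horizon: the free path between two successive reflections is uniformly bounded. -/
def FiniteHorizon : Prop := ∃ L : ℝ, ∀ x ∈ B.bdryM, ∃ t ∈ B.hitTimes x, t ≤ L

/-- The time between two successive reflections is bounded from below by a positive constant. -/
def FlightTimeBoundedBelow : Prop := ∃ τ₀ : ℝ, 0 < τ₀ ∧ ∀ x ∈ B.bdryM, ∀ t ∈ B.hitTimes x, τ₀ ≤ t

/-- No trajectory has more than `m` tangencies. (Counting along forward trajectories of all
starting points is the same as counting along two-sided trajectories.) -/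
def TangenciesAtMost (m : ℕ) : Prop :=
  ∀ x ∈ B.bdryM, {n : ℕ | B.billiardMap^[n] x ∈ B.tangential}.encard ≤ (m : ℕ∞)

/-- The surface measure `dq` on `∂Q`: the `(d-1)`-dimensional Hausdorff measure on the chosen lift
of each scatterer, transported to the torus. -/
def surfaceMeasure : Measure (Torus Λ) :=
  ∑ i, Measure.map (fun z : Space d => (z : Torus Λ))
    ((μH[(d : ℝ) - 1] : Measure (Space d)).restrict {z | B.R i z = 0})

/-- The Riemannian volume `dq dv` on `∂M`. -/
def volumeM : Measure (Phase Λ) :=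
  (B.surfaceMeasure.prod (volume : Measure (Space d)).toSphere).restrict B.bdryM

/-- The invariant measure `dμ₁ = |(v, n(q))| dq dv` of the billiard map (up to a normalizing
constant). -/
def invMeasure : Measure (Phase Λ) :=
  B.volumeM.withDensity fun x => ENNReal.ofReal |⟪(x.2 : Space d), B.normal x.1⟫|

end Scatterers

end DispersingBilliard

end

/-! The phase space `∂M` has dimension `2d - 2`, and both measures give a ball of radius `r` mass
`O(r^(2d-2))` (`exists_volumeM_ball_le`; the density of `μ₁` is at most 1). It therefore suffices to
cover `T⁻ᵏS` by `O(δ^{-(2d-3)})` sets of diameter `δ` (`hasCovers_singular`): enlarging them shows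
that the `δ`-neighbourhood has mass `O(δ)` (`HasCovers.measure_thickening_le`). This bounds `T⁻ᵏS`
as a whole, so every component inherits it and `U` can be all of `∂M ∖ S`.

Since `T` is singular at tangencies, the flight times are kept as additional unknowns in the
universal cover. For a fixed list of lifted scatterers, the orbit segments ending in a tangency
solve a system of equations in `(q, v, t)`. This system stays differentiable at grazing collisions,
because the reflection formula is regular wherever the gradient is nonzero. Finite horizon and
discreteness of `Λ` leave finitely many lists. If the differentials are independent, the solutions
have dimension `2d - 3`, and a 1-Lipschitz projection carries them onto a set containing `T⁻ᵏS`.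

Independence rests on `exists_deriv_chainMap`. A combination of the differentials that does not see
the flight times gives a covector `(p, w)` in the variables `(q, v)`. Followed backwards along the
orbit, the energy `⟪p, w⟫` does not decrease at a dispersing collision (`inner_le_inner_mirror`) and
gains `t‖p‖²` over a free flight. Hence zero energy forces the combination to be trivial. The two
remaining equations, `q` on a scatterer and `‖v‖ = 1`, can only be balanced by a combination of zero
energy. -/

noncomputable section

namespace DispersingBilliard

/-! ### Covering numbers -/

section Covers

variable {M M' : Type*} [PseudoMetricSpace M] [PseudoMetricSpace M']

/-- `A` can be covered by at most `C δ⁻ᵐ` sets of diameter at most `δ`, for all `δ ≤ 1`. -/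
def HasCovers (m : ℕ) (A : Set M) : Prop :=
  ∃ C : ℝ, ∀ δ : ℝ, 0 < δ → δ ≤ 1 → ∃ T : Finset (Set M), (T.card : ℝ) * δ ^ m ≤ C ∧
    A ⊆ ⋃ t ∈ T, t ∧ ∀ t ∈ T, ∀ x ∈ t, ∀ y ∈ t, dist x y ≤ δ

theorem HasCovers.empty (m : ℕ) : HasCovers m (∅ : Set M) :=
  ⟨0, fun _ _ _ => ⟨∅, by simp⟩⟩

theorem HasCovers.mono {m : ℕ} {A A' : Set M} (h : HasCovers m A) (hA : A' ⊆ A) :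
    HasCovers m A' := by
  obtain ⟨C, hC⟩ := h
  refine ⟨C, fun δ h0 h1 => ?_⟩
  obtain ⟨T, h, h', h''⟩ := hC δ h0 h1
  exact ⟨T, h, hA.trans h', h''⟩

theorem HasCovers.union {m : ℕ} {A A' : Set M} (h : HasCovers m A) (h' : HasCovers m A') :
    HasCovers m (A ∪ A') := by
  classical
  obtain ⟨C, hC⟩ := h
  obtain ⟨C', hC'⟩ := h'
  refine ⟨C + C', fun δ h0 h1 => ?_⟩
  obtain ⟨T, a, b, c⟩ := hC δ h0 h1
  obtain ⟨T', a', b', c'⟩ := hC' δ h0 h1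
  refine ⟨T ∪ T', ?_, ?_, ?_⟩
  · have : ((T ∪ T').card : ℝ) ≤ T.card + T'.card := by exact_mod_cast Finset.card_union_le _ _
    have hp : 0 ≤ δ ^ m := by positivity
    nlinarith
  · rintro x (hx | hx)
    · obtain ⟨t, ht, hxt⟩ := mem_iUnion₂.1 (b hx)
      exact mem_iUnion₂.2 ⟨t, Finset.mem_union_left _ ht, hxt⟩
    · obtain ⟨t, ht, hxt⟩ := mem_iUnion₂.1 (b' hx)
      exact mem_iUnion₂.2 ⟨t, Finset.mem_union_right _ ht, hxt⟩
  · intro t ht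
    rcases Finset.mem_union.1 ht with ht | ht
    exacts [c t ht, c' t ht]

theorem HasCovers.biUnion {ι : Type*} {m : ℕ} {I : Set ι} (hI : I.Finite) {A : ι → Set M}
    (h : ∀ i ∈ I, HasCovers m (A i)) : HasCovers m (⋃ i ∈ I, A i) := by
  induction I, hI using Set.Finite.induction_on with
  | empty => simpa using HasCovers.empty m
  | insert _ _ ih =>
    rw [biUnion_insert]
    exact (h _ (mem_insert _ _)).union (ih fun i hi => h i (mem_insert_of_mem _ hi))

/-- The property passes to subsets and finite unions, so compactness makes it local; the implicit
function argument is needed only near each point. -/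
theorem HasCovers.of_isCompact {m : ℕ} {A : Set M} (hA : IsCompact A)
    (h : ∀ a ∈ A, ∃ W ∈ nhds a, HasCovers m (A ∩ W)) : HasCovers m A := by
  have key : HasCovers m (A ∩ A) := by
    refine hA.induction_on (p := fun s => HasCovers m (A ∩ s)) ?_ ?_ ?_ ?_
    · simpa using HasCovers.empty m
    · intro s t hst ht
      exact ht.mono (inter_subset_inter_right _ hst)
    · intro s t hs ht
      rw [inter_union_distrib_left]
      exact hs.union ht
    · intro a ha
      obtain ⟨W, hW, hc⟩ := h a ha
      exact ⟨W, mem_nhdsWithin_of_mem_nhds hW, hc⟩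
  rwa [inter_self] at key

/-- Transfer of coverings along a relation which is Lipschitz in the second variable. -/
theorem HasCovers.of_relation {m : ℕ} {A : Set M} (h : HasCovers m A) {A' : Set M'}
    (r : M → M' → Prop) {L : ℝ} (hL : 0 ≤ L) (hr : ∀ y ∈ A', ∃ x ∈ A, r x y)
    (hrL : ∀ x ∈ A, ∀ x' ∈ A, ∀ y y', r x y → r x' y' → dist y y' ≤ L * dist x x') :
    HasCovers m A' := by
  classical
  obtain ⟨C, hC⟩ := h
  -- Cover `A` at scale `δ / (L + 1)`; the `+ 1` keeps the divisor positive and the scale at most 1.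
  refine ⟨C * (L + 1) ^ m, fun δ h0 h1 => ?_⟩
  have hδ : δ / (L + 1) ≤ 1 := by
    rw [div_le_one (by positivity)]; linarith
  obtain ⟨T, a, b, c⟩ := hC (δ / (L + 1)) (by positivity) hδ
  refine ⟨T.image fun t => {y | ∃ x ∈ A, x ∈ t ∧ r x y}, ?_, ?_, ?_⟩
  · have h2 : ((T.image fun t => {y | ∃ x ∈ A, x ∈ t ∧ r x y}).card : ℝ) ≤ T.card := by
      exact_mod_cast Finset.card_image_le
    rw [div_pow, mul_div_assoc', div_le_iff₀ (by positivity)] at a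
    refine le_trans ?_ a
    gcongr
  · intro y hy
    obtain ⟨x, hx, hxy⟩ := hr y hy
    obtain ⟨t, ht, hxt⟩ := mem_iUnion₂.1 (b hx)
    exact mem_iUnion₂.2 ⟨_, Finset.mem_image_of_mem _ ht, x, hx, hxt, hxy⟩
  · intro t ht
    obtain ⟨t₀, ht₀, rfl⟩ := Finset.mem_image.1 ht
    rintro y ⟨x, hxA, hx, hxy⟩ y' ⟨x', hxA', hx', hxy'⟩
    calc dist y y' ≤ L * dist x x' := hrL x hxA x' hxA' y y' hxy hxy'
      _ ≤ L * (δ / (L + 1)) := by gcongr; exact c t₀ ht₀ x hx x' hx'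
      _ ≤ δ := by
        rw [mul_div_assoc', div_le_iff₀ (by positivity)]; nlinarith

theorem hasCovers_of_isBounded {m : ℕ} {A : Set (Fin m → ℝ)} (hA : Bornology.IsBounded A) :
    HasCovers m A := by
  classical
  obtain ⟨R, hR0, hR⟩ := hA.subset_closedBall_lt 0 0
  -- Grid cells of side `δ` with indices in `[-N, N]`, where `N ≤ R / δ + 2`; then `(2 * N + 1) * δ
  -- ≤ 2 * R + 5 * δ ≤ 2 * R + 5`.
  refine ⟨(2 * R + 5) ^ m, fun δ h0 h1 => ?_⟩
  set N : ℕ := ⌈R / δ⌉₊ + 1 with hN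
  have hNR : R / δ + 1 ≤ N := by
    rw [hN]; push_cast; linarith [Nat.le_ceil (R / δ)]
  have hNle : (N : ℝ) ≤ R / δ + 2 := by
    rw [hN]; push_cast; linarith [Nat.ceil_lt_add_one (a := R / δ) (by positivity)]
  let cell : (Fin m → ℤ) → Set (Fin m → ℝ) := fun z => {x | ∀ i, ⌊x i / δ⌋ = z i}
  let G : Finset (Fin m → ℤ) := Fintype.piFinset fun _ => Finset.Icc (-(N : ℤ)) N
  refine ⟨G.image cell, ?_, ?_, ?_⟩
  · have h2 : ((G.image cell).card : ℝ) ≤ (2 * N + 1 : ℝ) ^ m := by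
      have : (G.image cell).card ≤ (2 * N + 1) ^ m := by
        refine Finset.card_image_le.trans ?_
        simp only [G, Fintype.card_piFinset, Int.card_Icc, Finset.prod_const, Finset.card_univ,
          Fintype.card_fin]
        apply Nat.pow_le_pow_left
        omega
      exact_mod_cast this
    calc ((G.image cell).card : ℝ) * δ ^ m ≤ (2 * N + 1 : ℝ) ^ m * δ ^ m := by gcongr
      _ = ((2 * N + 1) * δ) ^ m := by rw [mul_pow]
      _ ≤ (2 * R + 5) ^ m := by
        gcongr
        have : (2 * N + 1 : ℝ) * δ ≤ (2 * (R / δ + 2) + 1) * δ := by gcongr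
        have h3 : (2 * (R / δ + 2) + 1) * δ = 2 * R + 5 * δ := by field_simp; ring
        linarith
  · intro x hx
    have hx' := hR hx
    rw [mem_closedBall_zero_iff] at hx'
    refine mem_iUnion₂.2 ⟨cell fun i => ⌊x i / δ⌋, Finset.mem_image_of_mem _ ?_, fun i => rfl⟩
    refine Fintype.mem_piFinset.2 fun i => ?_
    have hi := (norm_le_pi_norm x i).trans hx'
    rw [Real.norm_eq_abs, abs_le] at hi
    have h5 : x i / δ ≤ R / δ := by gcongr; exact hi.2
    have h6 : -(R / δ) ≤ x i / δ := by rw [← neg_div]; gcongr; exact hi.1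
    rw [Finset.mem_Icc]
    constructor
    · rw [Int.le_floor]; push_cast; linarith
    · have : ((⌊x i / δ⌋ : ℤ) : ℝ) ≤ (N : ℤ) := by
        push_cast; linarith [Int.floor_le (x i / δ)]
      exact_mod_cast this
  · intro t ht
    obtain ⟨z, -, rfl⟩ := Finset.mem_image.1 ht
    intro x hx y hy
    rw [dist_pi_le_iff h0.le]
    intro i
    have h7 := Int.abs_sub_lt_one_of_floor_eq_floor ((hx i).trans (hy i).symm)
    rw [← sub_div, abs_div, abs_of_pos h0, div_lt_one h0] at h7
    exact h7.le

end Covers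

/-! ### Level sets near regular points -/

section LevelSets

variable {X F : Type*} [NormedAddCommGroup X] [NormedSpace ℝ X] [FiniteDimensional ℝ X]
  [NormedAddCommGroup F] [NormedSpace ℝ F]

/-- Near a regular point, a level set is controlled by a linear projection to `ℝᵐ`, where `m` is
the dimension of the kernel of the derivative. -/
theorem exists_projection_of_regular {Φ : X → F} {Φ' : X →L[ℝ] F} {a : X}
    (h : HasStrictFDerivAt Φ Φ' a) {m : ℕ} (hm : Module.finrank ℝ Φ'.ker = m) :
    ∃ (π : X →L[ℝ] (Fin m → ℝ)) (L : NNReal), ∃ W ∈ nhds a, ∀ x ∈ W, ∀ y ∈ W, Φ x = Φ y →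
      dist x y ≤ L * dist (π x) (π y) := by
  have hm' : Module.finrank ℝ Φ'.ker = Module.finrank ℝ (Fin m → ℝ) := by simp [hm]
  let e : Φ'.ker ≃ₗ[ℝ] (Fin m → ℝ) := LinearEquiv.ofFinrankEq _ _ hm'
  -- A linear retraction onto the kernel supplies the coordinates that `Φ'` misses, so that `Φ'.prod
  -- π` is injective and hence bounded below.
  obtain ⟨p, hp⟩ := Φ'.ker.subtype.exists_leftInverse_of_injective (by simp)
  let π : X →L[ℝ] (Fin m → ℝ) := LinearMap.toContinuousLinearMap (e.toLinearMap ∘ₗ p)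
  have hker : (Φ'.prod π).toLinearMap.ker = ⊥ := by
    rw [LinearMap.ker_eq_bot']
    intro x hx
    have h1 : Φ' x = 0 := congrArg Prod.fst hx
    have h2 : e (p x) = 0 := congrArg Prod.snd hx
    have h3 : p x = ⟨x, h1⟩ := LinearMap.congr_fun hp ⟨x, h1⟩
    rw [h3, LinearEquiv.map_eq_zero_iff] at h2
    exact congrArg Subtype.val h2
  obtain ⟨K, hK, hanti⟩ := LinearMap.exists_antilipschitzWith _ hker
  have hK' : (0 : ℝ) < K := hK
  -- With this constant, `K * ‖Φ' (x - y)‖` is at most half of `‖x - y‖` on a level set and is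
  -- absorbed by the left side.
  have h8 := h.isLittleO.def (c := 1 / (2 * K)) (by positivity)
  rw [nhds_prod_eq] at h8
  obtain ⟨W, hW, hWs⟩ := Filter.eventually_prod_self_iff'.1 h8
  refine ⟨π, 2 * K, W, hW, fun x hx y hy hxy => ?_⟩
  have h9 := hWs x hx y hy
  simp only [hxy, sub_self, zero_sub, norm_neg] at h9
  have h10 : dist x y ≤ K * dist ((Φ'.prod π) x) ((Φ'.prod π) y) := hanti.le_mul_dist x y
  have h11 : dist ((Φ'.prod π) x) ((Φ'.prod π) y) ≤ ‖Φ' (x - y)‖ + dist (π x) (π y) := by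
    simp only [ContinuousLinearMap.prod_apply, Prod.dist_eq]
    refine max_le ?_ ?_
    · rw [dist_eq_norm, ← map_sub]; linarith [dist_nonneg (x := π x) (y := π y)]
    · linarith [norm_nonneg (Φ' (x - y))]
  rw [dist_eq_norm x y] at h10 ⊢
  have h12 : K * ‖Φ' (x - y)‖ ≤ ‖x - y‖ / 2 := by
    calc K * ‖Φ' (x - y)‖ ≤ K * (1 / (2 * K) * ‖x - y‖) := by gcongr
      _ = ‖x - y‖ / 2 := by field_simp
  have h13 : ‖x - y‖ ≤ K * (‖Φ' (x - y)‖ + dist (π x) (π y)) :=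
    h10.trans (by gcongr)
  push_cast
  nlinarith

/-- Near a regular point, a bounded part of a level set has coverings of the expected size. -/
theorem hasCovers_level_of_regular {Φ : X → F} {Φ' : X →L[ℝ] F} {a : X}
    (h : HasStrictFDerivAt Φ Φ' a) {m : ℕ} (hm : Module.finrank ℝ Φ'.ker = m) {A : Set X}
    (hA : Bornology.IsBounded A) (hΦ : ∀ x ∈ A, ∀ y ∈ A, Φ x = Φ y) :
    ∃ W ∈ nhds a, HasCovers m (A ∩ W) := by
  obtain ⟨π, L, W, hW, hL⟩ := exists_projection_of_regular h hm
  refine ⟨W, hW, ?_⟩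
  have hb : Bornology.IsBounded (π '' (A ∩ W)) :=
    π.lipschitz.isBounded_image (hA.subset inter_subset_left)
  refine (hasCovers_of_isBounded hb).of_relation (fun y x => x ∈ A ∩ W ∧ π x = y) L.coe_nonneg
    (fun x hx => ⟨π x, mem_image_of_mem _ hx, hx, rfl⟩) ?_
  rintro _ - _ - x y ⟨hx, rfl⟩ ⟨hy, rfl⟩
  exact hL x hx.2 y hy.2 (hΦ x hx.1 y hy.1)

variable [MeasurableSpace X] [BorelSpace X]

/-- Near a regular point, a level set has the expected Hausdorff measure growth. -/
theorem hausdorffMeasure_level_of_regular {Φ : X → F} {Φ' : X →L[ℝ] F} {a : X}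
    (h : HasStrictFDerivAt Φ Φ' a) {m : ℕ} (hm : Module.finrank ℝ Φ'.ker = m) {A : Set X}
    (hΦ : ∀ x ∈ A, ∀ y ∈ A, Φ x = Φ y) :
    ∃ W ∈ nhds a, ∃ C : ℝ, ∀ (z : X) (r : ℝ), 0 < r →
      μH[(m : ℝ)] (A ∩ W ∩ ball z r) ≤ ENNReal.ofReal (C * r ^ m) := by
  obtain ⟨π, L, W, hW, hL⟩ := exists_projection_of_regular h hm
  refine ⟨W, hW, L ^ m * (2 * (‖π‖ + 1)) ^ m, fun z r hr => ?_⟩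
  set S : Set X := A ∩ W ∩ ball z r
  have hanti : AntilipschitzWith L fun x : S => π x :=
    AntilipschitzWith.of_le_mul_dist fun x y =>
      hL _ x.2.1.2 _ y.2.1.2 (hΦ _ x.2.1.1 _ y.2.1.1)
  have h1 := hanti.le_hausdorffMeasure_image (d := m) (by positivity) univ
  have h2 := (isometry_subtype_coe (s := S)).hausdorffMeasure_image (d := m)
    (Or.inl (by positivity)) univ
  rw [image_univ, Subtype.range_coe] at h2
  rw [h2]
  refine h1.trans ?_
  have h3 : (fun x : S => π x) '' univ ⊆ ball (π z) ((‖π‖ + 1) * r) := by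
    rintro _ ⟨x, -, rfl⟩
    rw [mem_ball, dist_eq_norm, ← map_sub]
    have hx : ‖(x : X) - z‖ < r := by simpa [dist_eq_norm] using x.2.2
    calc ‖π (x - z)‖ ≤ ‖π‖ * ‖(x : X) - z‖ := π.le_opNorm _
      _ ≤ ‖π‖ * r := by gcongr
      _ < (‖π‖ + 1) * r := by nlinarith
  have h4 : μH[(m : ℝ)] = (volume : Measure (Fin m → ℝ)) := by
    simpa using hausdorffMeasure_pi_real (ι := Fin m)
  calc (L : ENNReal) ^ (m : ℝ) * μH[(m : ℝ)] ((fun x : S => π x) '' univ)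
      ≤ (L : ENNReal) ^ (m : ℝ) * volume (ball (π z) ((‖π‖ + 1) * r)) := by
        rw [h4]; gcongr
    _ = ENNReal.ofReal (L ^ m * (2 * (‖π‖ + 1)) ^ m * r ^ m) := by
        rw [Real.volume_pi_ball _ (by positivity), ENNReal.rpow_natCast, Fintype.card_fin,
          ← ENNReal.ofReal_coe_nnreal, ← ENNReal.ofReal_pow (by positivity),
          ← ENNReal.ofReal_mul (by positivity)]
        congr 1
        rw [← mul_assoc 2, mul_pow _ r m, mul_assoc]

end LevelSets

/-! ### Reflections and the energy inequality -/

section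

variable {E : Type*} [NormedAddCommGroup E] [InnerProductSpace ℝ E]

/-- Reflection of `v` in the hyperplane orthogonal to `g`. -/
def mirror (g v : E) : E := v - (2 * ⟪g, v⟫ * ⟪g, g⟫⁻¹) • g

theorem inner_self_ne_zero_of_ne {g : E} (hg : g ≠ 0) : ⟪g, g⟫ ≠ (0 : ℝ) :=
  inner_self_ne_zero.2 hg

theorem inner_mirror_left {g : E} (hg : g ≠ 0) (v : E) : ⟪g, mirror g v⟫ = -⟪g, v⟫ := by
  have := inner_self_ne_zero_of_ne hg
  simp only [mirror, inner_sub_right, inner_smul_right]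
  field_simp
  ring

theorem inner_mirror_comm (g x y : E) : ⟪mirror g x, y⟫ = ⟪x, mirror g y⟫ := by
  simp only [mirror, inner_sub_right, inner_smul_right, inner_sub_left, real_inner_smul_left]
  rw [real_inner_comm x g]
  ring

theorem mirror_mirror {g : E} (hg : g ≠ 0) (v : E) : mirror g (mirror g v) = v := by
  have := inner_self_ne_zero_of_ne hg
  conv_lhs => rw [mirror, inner_mirror_left hg, mirror]
  module

theorem mirror_add_smul (g x y : E) (a : ℝ) :
    mirror g (x + a • y) = mirror g x + a • mirror g y := by
  simp only [mirror, inner_add_right, inner_smul_right]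
  module

theorem mirror_of_inner_eq_zero {g v : E} (h : ⟪g, v⟫ = 0) : mirror g v = v := by
  simp [mirror, h]

/-- The quantity `⟪p, w⟫` for a covector `(p, w)` does not decrease under the pull back by a
dispersing collision, provided that the position parts annihilate the flow direction. -/
theorem inner_le_inner_mirror {g u w p P z : E} {H : E →L[ℝ] E} {c : ℝ} (hg : g ≠ 0) (hu : u ≠ 0)
    (hpos : ∀ x : E, x ≠ 0 → ⟪g, x⟫ = 0 → 0 < ⟪H x, x⟫) (hgu : ⟪g, u⟫ ≤ 0)
    (hz : z = -⟪g, u⟫ • w - ⟪g, w⟫ • mirror g u)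
    (hP : P = p + c • g + (2 * ⟪g, g⟫⁻¹) • H z)
    (hp0 : ⟪p, mirror g u⟫ = 0) (hP0 : ⟪P, u⟫ = 0) : ⟪p, w⟫ ≤ ⟪P, mirror g w⟫ := by
  have hgg : 0 < (2 * ⟪g, g⟫⁻¹ : ℝ) := by
    have := real_inner_self_pos.2 hg
    positivity
  -- The vector `z` is tangent to the scatterer. Pairing it with `p` and with `P` gives `-⟪g, u⟫`
  -- times the two energies, and the pairings differ exactly by the curvature term.
  have hgz : ⟪g, z⟫ = 0 := by
    rw [hz, inner_sub_right, inner_smul_right, inner_smul_right, inner_mirror_left hg]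
    ring
  have hpz : ⟪p, z⟫ = -⟪g, u⟫ * ⟪p, w⟫ := by
    rw [hz, inner_sub_right, inner_smul_right, inner_smul_right, hp0]
    ring
  have hPz : ⟪P, z⟫ = ⟪p, z⟫ + (2 * ⟪g, g⟫⁻¹) * ⟪H z, z⟫ := by
    rw [hP, inner_add_left, inner_add_left, real_inner_smul_left, real_inner_smul_left, hgz]
    ring
  have hPz' : ⟪P, z⟫ = -⟪g, u⟫ * ⟪P, mirror g w⟫ := by
    have h1 : z = -⟪g, u⟫ • mirror g w - ⟪g, w⟫ • u := by
      rw [← mirror_of_inner_eq_zero hgz, hz, sub_eq_add_neg, ← neg_smul, add_comm,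
        mirror_add_smul]
      rw [show (-⟪g, w⟫) • mirror g u = 0 + (-⟪g, w⟫) • mirror g u by simp, mirror_add_smul,
        mirror_mirror hg]
      simp [mirror]
      module
    rw [h1, inner_sub_right, inner_smul_right, inner_smul_right, hP0]
    ring
  have hHz : 0 ≤ ⟪H z, z⟫ := by
    rcases eq_or_ne z 0 with h | h
    · simp [h]
    · exact (hpos z h hgz).le
  rcases hgu.lt_or_eq with hlt | heq
  · have : -⟪g, u⟫ * ⟪p, w⟫ ≤ -⟪g, u⟫ * ⟪P, mirror g w⟫ := by
      rw [← hpz, ← hPz', hPz]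
      have := mul_nonneg hgg.le hHz
      linarith
    exact le_of_mul_le_mul_left this (by linarith)
  -- Grazing collision: both pairings vanish, so positive curvature forces `z = 0`. Then `w` is
  -- tangent as well, and the energy is unchanged.
  · rw [heq] at hpz hPz'
    have h1 : (2 * ⟪g, g⟫⁻¹) * ⟪H z, z⟫ = 0 := by linarith
    have hz0 : z = 0 := by
      by_contra h
      exact (mul_pos hgg (hpos z h hgz)).ne' h1
    have hgw : ⟪g, w⟫ = 0 := by
      rw [hz, heq, mirror_of_inner_eq_zero heq] at hz0
      simpa [hu] using hz0
    rw [mirror_of_inner_eq_zero hgw, hP, hz0, inner_add_left, inner_add_left,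
      real_inner_smul_left, hgw]
    simp

/-- The derivative of the reflected velocity. -/
theorem exists_hasStrictFDerivAt_mirror {X : Type*} [NormedAddCommGroup X] [NormedSpace ℝ X]
    {G v : X → E} {G' v' : X →L[ℝ] E} {x : X} (hG : HasStrictFDerivAt G G' x)
    (hv : HasStrictFDerivAt v v' x) (hx : G x ≠ 0) :
    ∃ D : X →L[ℝ] E, HasStrictFDerivAt (fun y => mirror (G y) (v y)) D x ∧
      ∀ ξ, D ξ = v' ξ - (2 * (⟪G x, v' ξ⟫ + ⟪G' ξ, v x⟫) * ⟪G x, G x⟫⁻¹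
        - 4 * ⟪G x, v x⟫ * ⟪G x, G' ξ⟫ * ⟪G x, G x⟫⁻¹ ^ 2) • G x
        - (2 * ⟪G x, v x⟫ * ⟪G x, G x⟫⁻¹) • G' ξ := by
  have h0 := inner_self_ne_zero_of_ne hx
  have h1 := ((hG.inner ℝ hv).const_mul 2).mul
    ((hasStrictDerivAt_inv h0).comp_hasStrictFDerivAt x (hG.inner ℝ hG))
  refine ⟨_, hv.sub (h1.smul hG), fun ξ => ?_⟩
  simp only [sub_apply, add_apply, smul_apply, Pi.mul_apply, ContinuousLinearMap.smulRight_apply,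
    ContinuousLinearMap.comp_apply, ContinuousLinearMap.prod_apply, fderivInnerCLM_apply,
    Function.comp_apply, smul_eq_mul]
  rw [real_inner_comm (G x) (G' ξ)]
  module

/-- The adjoint of the derivative of the reflected velocity. -/
theorem inner_deriv_mirror {g u w ζ η : E} {H : E →L[ℝ] E}
    (hH : ∀ x y, ⟪H x, y⟫ = ⟪H y, x⟫) :
    ⟪w, η - (2 * (⟪g, η⟫ + ⟪H ζ, u⟫) * ⟪g, g⟫⁻¹ - 4 * ⟪g, u⟫ * ⟪g, H ζ⟫ * ⟪g, g⟫⁻¹ ^ 2) • g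
        - (2 * ⟪g, u⟫ * ⟪g, g⟫⁻¹) • H ζ⟫ =
      ⟪mirror g w, η⟫ + ⟪(2 * ⟪g, g⟫⁻¹) • H (-⟪g, u⟫ • w - ⟪g, w⟫ • mirror g u), ζ⟫ := by
  have e1 : ⟪H (-⟪g, u⟫ • w - ⟪g, w⟫ • mirror g u), ζ⟫
      = -⟪g, u⟫ * ⟪w, H ζ⟫ - ⟪g, w⟫ * (⟪H ζ, u⟫ - (2 * ⟪g, u⟫ * ⟪g, g⟫⁻¹) * ⟪g, H ζ⟫) := by
    rw [hH]
    simp only [mirror, inner_sub_right, inner_smul_right]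
    rw [real_inner_comm w (H ζ), real_inner_comm g (H ζ)]
  rw [real_inner_smul_left, e1]
  simp only [mirror, inner_sub_right, inner_smul_right, inner_sub_left, real_inner_smul_left]
  rw [real_inner_comm w g]
  ring

/-! ### Dispersing hypersurfaces and chains of collisions -/

variable [FiniteDimensional ℝ E]

/-- Functions whose zero level set is a dispersing hypersurface. -/
structure IsDispersing (ρ : E → ℝ) : Prop where
  contDiff : ContDiff ℝ 2 ρ
  gradient_ne_zero : ∀ z, ρ z = 0 → gradient ρ z ≠ 0
  curvature_pos : ∀ z, ρ z = 0 → ∀ w : E, w ≠ 0 → ⟪gradient ρ z, w⟫ = 0 →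
    0 < fderiv ℝ (fderiv ℝ ρ) z w w

namespace IsDispersing

variable {ρ : E → ℝ} (h : IsDispersing ρ)
include h

theorem hasStrictFDerivAt (z : E) : HasStrictFDerivAt ρ (innerSL ℝ (gradient ρ z)) z := by
  have h1 := (h.contDiff.contDiffAt (x := z)).hasStrictFDerivAt (by norm_num)
  have h2 : innerSL ℝ (gradient ρ z) = fderiv ℝ ρ z := by
    ext y
    simp
  rwa [h2]

theorem continuous_gradient : Continuous (gradient ρ) :=
  (InnerProductSpace.toDual ℝ E).symm.continuous.comp (h.contDiff.continuous_fderiv (by norm_num))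

theorem exists_hessian (z : E) : ∃ H : E →L[ℝ] E, HasStrictFDerivAt (gradient ρ) H z ∧
    (∀ x y, ⟪H x, y⟫ = fderiv ℝ (fderiv ℝ ρ) z x y) ∧ ∀ x y, ⟪H x, y⟫ = ⟪H y, x⟫ := by
  have h1 : ContDiff ℝ 1 (fderiv ℝ ρ) := h.contDiff.fderiv_right (by norm_num)
  have h2 := (h1.contDiffAt (x := z)).hasStrictFDerivAt (by norm_num)
  let T : (StrongDual ℝ E) →L[ℝ] E :=
    ((InnerProductSpace.toDual ℝ E).symm.toContinuousLinearEquiv.toContinuousLinearMap :)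
  have h3 : HasStrictFDerivAt (gradient ρ) (T ∘L fderiv ℝ (fderiv ℝ ρ) z) z :=
    T.hasStrictFDerivAt.comp z h2
  have h4 : ∀ x y, ⟪(T ∘L fderiv ℝ (fderiv ℝ ρ) z) x, y⟫ = fderiv ℝ (fderiv ℝ ρ) z x y := by
    intro x y
    simp [T]
  refine ⟨_, h3, h4, fun x y => ?_⟩
  rw [h4, h4]
  exact (h.contDiff.contDiffAt (x := z)).isSymmSndFDerivAt (by simp) x y

end IsDispersing

/-- For a sequence of `n + 1` collisions with the hypersurfaces `ρ i = 0`, with initial line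
`(q, v)` and flight times `t`: the values of the functions `ρ i` at the collision points, and the
scalar product of the last incoming velocity with the gradient. -/
def chainMap : (n : ℕ) → (Fin (n + 1) → E → ℝ) → E × E × (Fin (n + 1) → ℝ) → (Fin (n + 2) → ℝ)
  | 0, ρ, x => Fin.cons (ρ 0 (x.1 + x.2.2 0 • x.2.1))
      fun _ => ⟪gradient (ρ 0) (x.1 + x.2.2 0 • x.2.1), x.2.1⟫
  | n + 1, ρ, x => Fin.cons (ρ 0 (x.1 + x.2.2 0 • x.2.1))
      (chainMap n (Fin.tail ρ) (x.1 + x.2.2 0 • x.2.1,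
        mirror (gradient (ρ 0) (x.1 + x.2.2 0 • x.2.1)) x.2.1, Fin.tail x.2.2))

/-- Sequences of `n + 1` collisions as above with flight times in `[a, b]`, which come from
outside, and the last of which is tangential. -/
def chainSet (a b : ℝ) : (n : ℕ) → (Fin (n + 1) → E → ℝ) → Set (E × E × (Fin (n + 1) → ℝ))
  | 0, ρ => {x | x.2.2 0 ∈ Icc a b ∧ ‖x.2.1‖ = 1 ∧ ρ 0 (x.1 + x.2.2 0 • x.2.1) = 0 ∧
      ⟪gradient (ρ 0) (x.1 + x.2.2 0 • x.2.1), x.2.1⟫ = 0}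
  | n + 1, ρ => {x | x.2.2 0 ∈ Icc a b ∧ ‖x.2.1‖ = 1 ∧ ρ 0 (x.1 + x.2.2 0 • x.2.1) = 0 ∧
      ⟪gradient (ρ 0) (x.1 + x.2.2 0 • x.2.1), x.2.1⟫ ≤ 0} ∩
      {x | (x.1 + x.2.2 0 • x.2.1, mirror (gradient (ρ 0) (x.1 + x.2.2 0 • x.2.1)) x.2.1,
        Fin.tail x.2.2) ∈ chainSet a b n (Fin.tail ρ)}

theorem chainMap_eq_zero {a b : ℝ} : ∀ {n : ℕ} {ρ : Fin (n + 1) → E → ℝ}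
    {x : E × E × (Fin (n + 1) → ℝ)}, x ∈ chainSet a b n ρ → chainMap n ρ x = 0
  | 0, ρ, x, hx => by
    ext i
    refine Fin.cases ?_ (fun j => ?_) i
    · exact hx.2.2.1
    · exact hx.2.2.2
  | n + 1, ρ, x, hx => by
    ext i
    refine Fin.cases ?_ (fun j => ?_) i
    · exact hx.1.2.2.1
    · exact congrFun (chainMap_eq_zero hx.2) j

theorem norm_eq_one_of_mem_chainSet {a b : ℝ} : ∀ {n : ℕ} {ρ : Fin (n + 1) → E → ℝ}
    {x : E × E × (Fin (n + 1) → ℝ)}, x ∈ chainSet a b n ρ → ‖x.2.1‖ = 1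
  | 0, _, _, hx => hx.2.1
  | _ + 1, _, _, hx => hx.1.2.1

theorem time_mem_of_mem_chainSet {a b : ℝ} : ∀ {n : ℕ} {ρ : Fin (n + 1) → E → ℝ}
    {x : E × E × (Fin (n + 1) → ℝ)}, x ∈ chainSet a b n ρ → ∀ i, x.2.2 i ∈ Icc a b
  | 0, _, _, hx, i => by
    rw [Fin.fin_one_eq_zero i]
    exact hx.1
  | n + 1, ρ, x, hx, i => by
    refine Fin.cases ?_ (fun j => ?_) i
    · exact hx.1.1
    · exact time_mem_of_mem_chainSet hx.2 j

/-- The reflected velocity is continuous only where the gradient is nonzero. The conditions on the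
first collision cut out a closed set with this property, and the remaining ones are pulled back
within it. -/
theorem isClosed_chainSet (a b : ℝ) : ∀ {n : ℕ} {ρ : Fin (n + 1) → E → ℝ},
    (∀ i, IsDispersing (ρ i)) → IsClosed (chainSet a b n ρ)
  | 0, ρ, hρ => by
    have h1 := (hρ 0).contDiff.continuous
    have h2 := (hρ 0).continuous_gradient
    have hq : Continuous fun x : E × E × (Fin 1 → ℝ) => x.1 + x.2.2 0 • x.2.1 := by fun_prop
    refine (isClosed_Icc.preimage (by fun_prop)).inter ((isClosed_eq (by fun_prop)
      (by fun_prop)).inter ((isClosed_eq (h1.comp hq) (by fun_prop)).inter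
      (isClosed_eq ((h2.comp hq).inner (by fun_prop)) (by fun_prop))))
  | n + 1, ρ, hρ => by
    have h1 := (hρ 0).contDiff.continuous
    have h2 := (hρ 0).continuous_gradient
    have hq : Continuous fun x : E × E × (Fin (n + 2) → ℝ) => x.1 + x.2.2 0 • x.2.1 := by fun_prop
    have hg := h2.comp hq
    have hi : IsClosed {x : E × E × (Fin (n + 2) → ℝ) |
        ⟪gradient (ρ 0) (x.1 + x.2.2 0 • x.2.1), x.2.1⟫ ≤ 0} :=
      isClosed_le (hg.inner (by fun_prop)) continuous_const
    refine ContinuousOn.preimage_isClosed_of_isClosed ?_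
      ((isClosed_Icc.preimage (by fun_prop)).inter ((isClosed_eq (by fun_prop)
      (by fun_prop)).inter ((isClosed_eq (h1.comp hq) (by fun_prop)).inter hi)))
      (isClosed_chainSet a b (n := n) fun i => hρ i.succ)
    refine hq.continuousOn.prodMk (ContinuousOn.prodMk ?_ ?_)
    · have hv : Continuous fun x : E × E × (Fin (n + 2) → ℝ) => x.2.1 := by fun_prop
      refine hv.continuousOn.sub (ContinuousOn.smul (ContinuousOn.mul ?_
        (ContinuousOn.inv₀ (hg.inner hg).continuousOn ?_)) hg.continuousOn)
      · exact ((hg.inner hv).const_smul (2 : ℝ)).continuousOn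
      · intro x hx
        exact inner_self_ne_zero_of_ne ((hρ 0).gradient_ne_zero _ hx.2.2.1)
    · exact Continuous.continuousOn (continuous_pi fun i => by
        simp only [Fin.tail]; fun_prop)

theorem isCompact_inter_chainSet (a b : ℝ) {n : ℕ} {ρ : Fin (n + 1) → E → ℝ}
    (hρ : ∀ i, IsDispersing (ρ i)) {S : Set E} (hS : IsCompact S) :
    IsCompact ({x | x.1 ∈ S} ∩ chainSet a b n ρ) := by
  refine (hS.prod ((isCompact_closedBall (0 : E) 1).prod
    (isCompact_univ_pi fun _ : Fin (n + 1) => isCompact_Icc (a := a) (b := b)))).of_isClosed_subset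
    ((hS.isClosed.preimage continuous_fst).inter (isClosed_chainSet a b hρ)) ?_
  rintro x ⟨hx, hx'⟩
  exact ⟨hx, mem_closedBall_zero_iff.2 (norm_eq_one_of_mem_chainSet hx').le,
    fun i _ => time_mem_of_mem_chainSet hx' i⟩

end

/-! ### Regularity of the collision equations -/

section

variable {E : Type*} [NormedAddCommGroup E] [InnerProductSpace ℝ E]

theorem hasStrictFDerivAt_velocity {n : ℕ} (x : E × E × (Fin n → ℝ)) :
    HasStrictFDerivAt (fun x : E × E × (Fin n → ℝ) => x.2.1)
      (ContinuousLinearMap.fst ℝ _ _ ∘L ContinuousLinearMap.snd ℝ _ _) x :=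
  (ContinuousLinearMap.fst ℝ _ _ ∘L
    ContinuousLinearMap.snd ℝ E (E × (Fin n → ℝ))).hasStrictFDerivAt

/-- The end point of a free flight as a function of the initial data and the flight times. -/
theorem hasStrictFDerivAt_flight {n : ℕ} (x : E × E × (Fin (n + 1) → ℝ)) :
    ∃ D : E × E × (Fin (n + 1) → ℝ) →L[ℝ] E,
      HasStrictFDerivAt (fun x : E × E × (Fin (n + 1) → ℝ) => x.1 + x.2.2 0 • x.2.1) D x ∧
      ∀ ξ η τ, D (ξ, η, τ) = ξ + x.2.2 0 • η + τ 0 • x.2.1 := by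
  have h1 : HasStrictFDerivAt (fun x : E × E × (Fin (n + 1) → ℝ) => x.2.2 0)
      (ContinuousLinearMap.proj 0 ∘L ContinuousLinearMap.snd ℝ _ _ ∘L
        ContinuousLinearMap.snd ℝ _ _) x :=
    (ContinuousLinearMap.proj (φ := fun _ : Fin (n + 1) => ℝ) 0 ∘L ContinuousLinearMap.snd ℝ _ _ ∘L
      ContinuousLinearMap.snd ℝ E (E × (Fin (n + 1) → ℝ))).hasStrictFDerivAt
  have h2 := hasStrictFDerivAt_velocity x
  refine ⟨_, hasStrictFDerivAt_fst.add (h1.smul h2), fun ξ η τ => ?_⟩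
  simp [add_assoc]

variable [FiniteDimensional ℝ E]

theorem exists_inner_eq (f : E →L[ℝ] ℝ) : ∃ p : E, ∀ ξ, f ξ = ⟪p, ξ⟫ :=
  ⟨(InnerProductSpace.toDual ℝ E).symm f, fun ξ => by simp⟩

theorem map_finCons {n : ℕ} (φ : (Fin (n + 1) → ℝ) →L[ℝ] ℝ) :
    ∃ (c : ℝ) (φ' : (Fin n → ℝ) →L[ℝ] ℝ), ∀ a b, φ (Fin.cons a b) = c * a + φ' b := by
  let J : (Fin n → ℝ) →ₗ[ℝ] (Fin (n + 1) → ℝ) :=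
    { toFun := fun b => Fin.cons 0 b
      map_add' := fun x y => by ext i; refine Fin.cases ?_ (fun j => ?_) i <;> simp
      map_smul' := fun x y => by ext i; refine Fin.cases ?_ (fun j => ?_) i <;> simp }
  refine ⟨φ (Fin.cons 1 0), φ ∘L LinearMap.toContinuousLinearMap J, fun a b => ?_⟩
  have h : (Fin.cons a b : Fin (n + 1) → ℝ) = a • Fin.cons 1 0 + J b := by
    ext i; refine Fin.cases ?_ (fun j => ?_) i <;> simp [J]
  rw [h, map_add, map_smul, mul_comm]
  rfl

theorem finCons_ext {n : ℕ} {φ : (Fin (n + 1) → ℝ) →L[ℝ] ℝ} (h : ∀ a b, φ (Fin.cons a b) = 0) :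
    φ = 0 := by
  ext x
  rw [← Fin.cons_self_tail x]
  exact h _ _

/-- A conormal vector of a sequence of collisions, which does not see the flight times, has
nonnegative energy, which vanishes only if the conormal vector does. -/
def IsCoercive {n m : ℕ} (v : E) (L : E × E × (Fin n → ℝ) →L[ℝ] (Fin m → ℝ)) : Prop :=
  ∀ φ : (Fin m → ℝ) →L[ℝ] ℝ, (∀ τ, φ (L (0, 0, τ)) = 0) → φ (L (v, 0, 0)) = 0 ∧
    ∀ p w : E, (∀ ξ, φ (L (ξ, 0, 0)) = ⟪p, ξ⟫) → (∀ η, φ (L (0, η, 0)) = ⟪w, η⟫) →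
      0 ≤ ⟪p, w⟫ ∧ (⟪p, w⟫ = 0 → φ = 0)

/-- Induction from the final tangency backwards: prepending a flight and a reflection acts on
covectors by the adjoint of the linearised step. The bound `0 < a` makes the energy gained in a
flight control the covector. -/
theorem exists_deriv_chainMap {a b : ℝ} (ha : 0 < a) : ∀ {n : ℕ} {ρ : Fin (n + 1) → E → ℝ}
    (_ : ∀ i, IsDispersing (ρ i)) {x : E × E × (Fin (n + 1) → ℝ)} (_ : x ∈ chainSet a b n ρ),
    ∃ L, HasStrictFDerivAt (chainMap n ρ) L x ∧ IsCoercive x.2.1 L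
  | 0, ρ, hρ, x, hx => by
    obtain ⟨D, hD, hD'⟩ := hasStrictFDerivAt_flight x
    set q := x.1 + x.2.2 0 • x.2.1 with hq
    obtain ⟨H, hH, hHf, hHs⟩ := (hρ 0).exists_hessian q
    set g := gradient (ρ 0) q with hg
    have hx0 : x.2.1 ≠ 0 := fun h => by simpa [h] using hx.2.1
    have hgx : ⟪g, x.2.1⟫ = 0 := hx.2.2.2
    have hg0 : g ≠ 0 := (hρ 0).gradient_ne_zero _ hx.2.2.1
    have h1 := ((hρ 0).hasStrictFDerivAt q).comp x hD
    have h2 := hasStrictFDerivAt_velocity x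
    have h3 := (hH.comp x hD).inner ℝ h2
    have h4 := h1.finCons (F' := fun _ => ℝ) (hasStrictFDerivAt_pi.2 fun _ : Fin 1 => h3)
    obtain ⟨L, hL, hLa⟩ : ∃ L : E × E × (Fin 1 → ℝ) →L[ℝ] (Fin 2 → ℝ),
        HasStrictFDerivAt (chainMap 0 ρ) L x ∧ ∀ ξ η τ, L (ξ, η, τ) =
        Fin.cons ⟪g, ξ + x.2.2 0 • η + τ 0 • x.2.1⟫
          fun _ => ⟪g, η⟫ + ⟪H (ξ + x.2.2 0 • η + τ 0 • x.2.1), x.2.1⟫ := by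
      refine ⟨_, h4, fun ξ η τ => ?_⟩
      ext i
      refine Fin.cases ?_ (fun j => ?_) i
      · simp [hD', ← hg]
      · simp [hD', ← hq, ← hg]
    refine ⟨L, hL, fun φ hτ => ?_⟩
    obtain ⟨c, φ', hφ⟩ := map_finCons φ
    obtain ⟨e, φ'', hφ'⟩ := map_finCons φ'
    have hφ2 : ∀ s r : ℝ, φ (Fin.cons s fun _ => r) = c * s + e * r := by
      intro s r
      have : (fun _ => r : Fin 1 → ℝ) = Fin.cons r 0 := by
        ext i; rw [Fin.fin_one_eq_zero i]; rfl
      rw [hφ, this, hφ', map_zero, add_zero]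
    -- Along the flight direction the hit equation is stationary, while the tangency equation has
    -- derivative equal to the second derivative of `ρ 0` on the tangent vector `x.2.1`, which is
    -- positive.
    have he : e = 0 := by
      have := hτ fun _ => 1
      rw [hLa, hφ2] at this
      simp only [inner_zero_right, smul_zero, add_zero, zero_add, one_smul, hgx, mul_zero,
        mul_eq_zero] at this
      refine this.resolve_right ?_
      rw [hHf]
      exact ((hρ 0).curvature_pos _ hx.2.2.1 _ hx0 hgx).ne'
    have hLc : ∀ ξ η τ, φ (L (ξ, η, τ)) = c * ⟪g, ξ + x.2.2 0 • η + τ 0 • x.2.1⟫ := by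
      intro ξ η τ
      rw [hLa, hφ2, he, zero_mul, add_zero]
    refine ⟨by simp [hLc, hgx], fun p w hp hw => ?_⟩
    have hp' : p = c • g := ext_inner_right ℝ fun ξ => by
      rw [← hp, hLc, real_inner_smul_left]; simp
    have hw' : w = x.2.2 0 • p := ext_inner_right ℝ fun η => by
      rw [← hw, hLc, hp', real_inner_smul_left, real_inner_smul_left]
      simp [inner_smul_right]; ring
    have ht : 0 < x.2.2 0 := ha.trans_le hx.1.1
    rw [hw', inner_smul_right]
    refine ⟨mul_nonneg ht.le real_inner_self_nonneg, fun h0 => ?_⟩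
    have hp0 : p = 0 := by simpa [ht.ne'] using h0
    have hc : c = 0 := by simpa [hp', hg0] using hp0
    refine finCons_ext fun s r => ?_
    have : r = fun _ => r 0 := by
      ext i; rw [Fin.fin_one_eq_zero i]
    rw [this, hφ2, hc, he]
    ring
  | n + 1, ρ, hρ, x, hx => by
    obtain ⟨D, hD, hD'⟩ := hasStrictFDerivAt_flight x
    set q := x.1 + x.2.2 0 • x.2.1 with hq
    obtain ⟨H, hH, hHf, hHs⟩ := (hρ 0).exists_hessian q
    set g := gradient (ρ 0) q with hg
    set u := x.2.1 with hu
    have hu0 : u ≠ 0 := fun h => by simpa [← hu, h] using hx.1.2.1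
    have hgu : ⟪g, u⟫ ≤ 0 := hx.1.2.2.2
    have hg0 : g ≠ 0 := (hρ 0).gradient_ne_zero _ hx.1.2.2.1
    obtain ⟨L', hL', hc'⟩ := exists_deriv_chainMap ha (fun i => hρ (Fin.succ i)) hx.2
    have h1 := ((hρ 0).hasStrictFDerivAt q).comp x hD
    have h2 := hasStrictFDerivAt_velocity x
    obtain ⟨V, hV, hV'⟩ := exists_hasStrictFDerivAt_mirror (hH.comp x hD) h2 hg0
    let tl : E × E × (Fin (n + 2) → ℝ) →L[ℝ] (Fin (n + 1) → ℝ) :=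
      ContinuousLinearMap.pi fun i => ContinuousLinearMap.proj (Fin.succ i) ∘L
        ContinuousLinearMap.snd ℝ _ _ ∘L ContinuousLinearMap.snd ℝ _ _
    have h3 : HasStrictFDerivAt (fun x : E × E × (Fin (n + 2) → ℝ) =>
        (Fin.tail x.2.2 : Fin (n + 1) → ℝ)) tl x := tl.hasStrictFDerivAt
    have h4 := hL'.comp x (hD.prodMk (hV.prodMk h3))
    have h5 := h1.finCons (F' := fun _ => ℝ) h4
    obtain ⟨L, hL, hLc⟩ : ∃ L : E × E × (Fin (n + 2) → ℝ) →L[ℝ] (Fin (n + 3) → ℝ),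
        HasStrictFDerivAt (chainMap (n + 1) ρ) L x ∧ ∀ ξ η τ, L (ξ, η, τ) =
        Fin.cons ⟪g, ξ + x.2.2 0 • η + τ 0 • u⟫
          (L' (D (ξ, η, τ), V (ξ, η, τ), Fin.tail τ)) := by
      refine ⟨_, h5, fun ξ η τ => ?_⟩
      ext i
      refine Fin.cases ?_ (fun j => ?_) i
      · simp [hD', ← hg]
      · simp [tl]; rfl
    refine ⟨L, hL, fun φ hτ => ?_⟩
    obtain ⟨c, φ', hφ⟩ := map_finCons φ
    obtain ⟨p', hp'⟩ := exists_inner_eq (φ' ∘L L' ∘L ContinuousLinearMap.inl ℝ _ _)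
    obtain ⟨w', hw'⟩ := exists_inner_eq (φ' ∘L L' ∘L ContinuousLinearMap.inr ℝ _ _ ∘L
      ContinuousLinearMap.inl ℝ _ _)
    have hp'' : ∀ ξ, φ' (L' (ξ, 0, 0)) = ⟪p', ξ⟫ := hp'
    have hw'' : ∀ η, φ' (L' (0, η, 0)) = ⟪w', η⟫ := hw'
    have hsplit : ∀ ξ η τ, φ' (L' (ξ, η, τ)) = ⟪p', ξ⟫ + ⟪w', η⟫ + φ' (L' (0, 0, τ)) := by
      intro ξ η τ
      rw [← hp'', ← hw'', ← map_add, ← map_add, ← map_add, ← map_add]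
      simp
    -- The covector just before the collision is `(P, mirror g w')`: `c • g` comes from the new hit
    -- equation, the `H z` term from the turning of the normal with the collision point.
    set z := -⟪g, u⟫ • w' - ⟪g, w'⟫ • mirror g u with hz
    set P := p' + c • g + (2 * ⟪g, g⟫⁻¹) • H z with hP
    have hLa : ∀ ξ η τ, φ (L (ξ, η, τ)) = ⟪P, ξ + x.2.2 0 • η + τ 0 • u⟫ + ⟪mirror g w', η⟫
        + φ' (L' (0, 0, Fin.tail τ)) := by
      intro ξ η τ
      have hVa : V (ξ, η, τ) = η - (2 * (⟪g, η⟫ + ⟪H (D (ξ, η, τ)), u⟫) * ⟪g, g⟫⁻¹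
          - 4 * ⟪g, u⟫ * ⟪g, H (D (ξ, η, τ))⟫ * ⟪g, g⟫⁻¹ ^ 2) • g
          - (2 * ⟪g, u⟫ * ⟪g, g⟫⁻¹) • H (D (ξ, η, τ)) := hV' (ξ, η, τ)
      rw [hLc, hφ, hsplit, hVa, inner_deriv_mirror hHs, ← hz, hP, inner_add_left, inner_add_left,
        real_inner_smul_left g, hD']
      ring
    have hτ' : ∀ τ, φ' (L' (0, 0, τ)) = 0 := by
      intro τ
      have := hτ (Fin.cons 0 τ)
      rw [hLa] at this
      simpa using this
    -- Varying only the first flight time moves the collision point along `u`.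
    have hPu : ⟪P, u⟫ = 0 := by
      have := hτ (Fin.cons 1 0)
      rw [hLa, hτ'] at this
      simpa using this
    obtain ⟨hpu, hc''⟩ := hc' φ' hτ'
    obtain ⟨hpos, heq⟩ := hc'' p' w' hp'' hw''
    rw [hp''] at hpu
    have hstep : ⟪p', w'⟫ ≤ ⟪P, mirror g w'⟫ := inner_le_inner_mirror hg0 hu0
      (fun y hy hgy => by rw [hHf]; exact (hρ 0).curvature_pos _ hx.1.2.2.1 _ hy hgy)
      hgu hz hP hpu hPu
    refine ⟨by rw [hLa, hτ']; simp [hPu], fun p w hp hw => ?_⟩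
    have hpP : p = P := ext_inner_right ℝ fun ξ => by
      rw [← hp, hLa, hτ']; simp
    have hwP : w = mirror g w' + x.2.2 0 • P := ext_inner_right ℝ fun η => by
      rw [← hw, hLa, hτ', inner_add_left (mirror g w'), real_inner_smul_left P]
      simp only [inner_smul_right, zero_add, Pi.zero_apply, zero_smul, add_zero]
      ring
    have ht : 0 < x.2.2 0 := ha.trans_le hx.1.1.1
    have hPP : 0 ≤ x.2.2 0 * ⟪P, P⟫ := mul_nonneg ht.le real_inner_self_nonneg
    rw [hpP, hwP, inner_add_right, inner_smul_right]
    refine ⟨by linarith, fun h0 => ?_⟩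
    have hP0 : P = 0 := by
      have : x.2.2 0 * ⟪P, P⟫ = 0 := by linarith
      simpa [ht.ne'] using this
    have hφ'0 : φ' = 0 := heq (by linarith)
    have hp'0 : p' = 0 := ext_inner_right ℝ fun ξ => by rw [← hp'', hφ'0]; simp
    have hw'0 : w' = 0 := ext_inner_right ℝ fun ξ => by rw [← hw'', hφ'0]; simp
    have hz0 : z = 0 := by rw [hz, hw'0]; simp
    have hc : c = 0 := by
      rw [hP, hp'0, hz0] at hP0
      simpa [hg0] using hP0
    refine finCons_ext fun s r => ?_
    rw [hφ, hc, hφ'0]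
    simp

/-- Orbit segments with a tangency at the end form a set of dimension `2 dim E - 3`. -/
theorem hasCovers_chainSet {a b : ℝ} (ha : 0 < a) {n : ℕ} {ρ₀ : E → ℝ} {ρ : Fin (n + 1) → E → ℝ}
    (hρ₀ : IsDispersing ρ₀) (hρ : ∀ i, IsDispersing (ρ i)) (hc : IsCompact {z | ρ₀ z = 0})
    (hE : 2 ≤ Module.finrank ℝ E) :
    HasCovers (2 * Module.finrank ℝ E - 3) ({x | ρ₀ x.1 = 0} ∩ chainSet a b n ρ) := by
  have hcomp := isCompact_inter_chainSet a b hρ hc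
  refine HasCovers.of_isCompact hcomp fun x hx => ?_
  obtain ⟨L, hL, hco⟩ := exists_deriv_chainMap ha hρ hx.2
  have h1 : HasStrictFDerivAt (fun x : E × E × (Fin (n + 1) → ℝ) => ρ₀ x.1)
    (innerSL ℝ (gradient ρ₀ x.1) ∘L ContinuousLinearMap.fst ℝ _ _) x :=
    (hρ₀.hasStrictFDerivAt x.1).comp x hasStrictFDerivAt_fst
  have h2 := hasStrictFDerivAt_velocity x
  have hv : ‖x.2.1‖ = 1 := norm_eq_one_of_mem_chainSet hx.2
  have hv0 : x.2.1 ≠ 0 := fun h => by simp [h] at hv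
  obtain ⟨Φ', h3, hΦa⟩ : ∃ Φ' : E × E × (Fin (n + 1) → ℝ) →L[ℝ] ℝ × ℝ × (Fin (n + 2) → ℝ),
      HasStrictFDerivAt (fun x => (ρ₀ x.1, ⟪x.2.1, x.2.1⟫, chainMap n ρ x)) Φ' x ∧
      ∀ ξ η τ, Φ' (ξ, η, τ) = (⟪gradient ρ₀ x.1, ξ⟫, 2 * ⟪x.2.1, η⟫, L (ξ, η, τ)) := by
    refine ⟨_, h1.prodMk ((h2.inner ℝ h2).prodMk hL), fun ξ η τ => ?_⟩
    have := real_inner_comm x.2.1 η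
    simp [this]
    ring
  -- By duality: a functional annihilating the range must vanish.
  have hsurj : Function.Surjective Φ' := by
    have : Function.Injective Φ'.toLinearMap.dualMap := by
      rw [injective_iff_map_eq_zero]
      intro f hf
      have hf' : ∀ y, f (Φ' y) = 0 := fun y => LinearMap.congr_fun hf y
      let φ : (Fin (n + 2) → ℝ) →L[ℝ] ℝ := LinearMap.toContinuousLinearMap
        (f ∘ₗ LinearMap.inr ℝ ℝ (ℝ × (Fin (n + 2) → ℝ)) ∘ₗ LinearMap.inr ℝ ℝ (Fin (n + 2) → ℝ))
      set α := f (1, 0, 0) with hα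
      set β := f (0, 1, 0) with hβ
      have hsplit : ∀ r s y, f (r, s, y) = r * α + s * β + φ y := by
        intro r s y
        have : (r, s, y) = r • ((1, 0, 0) : ℝ × ℝ × (Fin (n + 2) → ℝ)) + s • (0, 1, 0)
          + (0, 0, y) := by simp
        rw [this, map_add, map_add, map_smul, map_smul]
        rfl
      have hφL : ∀ ξ η τ, φ (L (ξ, η, τ)) =
          -(⟪gradient ρ₀ x.1, ξ⟫ * α) - 2 * ⟪x.2.1, η⟫ * β := by
        intro ξ η τ
        have := hf' (ξ, η, τ)
        rw [hΦa, hsplit] at this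
        linarith
      obtain ⟨hp0, hco'⟩ := hco φ fun τ => by simp [hφL]
      obtain ⟨-, hz⟩ := hco' (-α • gradient ρ₀ x.1) ((-(2 * β)) • x.2.1)
        (fun ξ => by rw [hφL, real_inner_smul_left]; simp; ring)
        (fun η => by rw [hφL, real_inner_smul_left]; simp; ring)
      -- The energy is `2 * α * β * ⟪gradient ρ₀ x.1, x.2.1⟫`, and `hp0` says that `α * ⟪gradient ρ₀
      -- x.1, x.2.1⟫` vanishes.
      have hφ0 : φ = 0 := by
        apply hz
        rw [hφL] at hp0
        rw [real_inner_smul_left, inner_smul_right]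
        simp only [inner_zero_right, mul_zero, zero_mul, sub_zero, neg_eq_zero] at hp0
        linear_combination (2 * β) * hp0
      have hα0 : α = 0 := by
        have := hφL (gradient ρ₀ x.1) 0 0
        rw [hφ0] at this
        simpa [hρ₀.gradient_ne_zero _ hx.1] using this
      have hβ0 : β = 0 := by
        have := hφL 0 x.2.1 0
        rw [hφ0] at this
        simpa [hv0] using this
      refine LinearMap.ext fun ⟨r, s, y⟩ => ?_
      rw [hsplit, hα0, hβ0, hφ0]
      simp
    exact LinearMap.dualMap_injective_iff.1 this
  -- There are `2 * finrank E + (n + 1)` unknowns and `1 + 1 + (n + 2)` independent equations.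
  have hrank : Module.finrank ℝ Φ'.ker = 2 * Module.finrank ℝ E - 3 := by
    have h5 := LinearMap.finrank_range_add_finrank_ker Φ'.toLinearMap
    rw [LinearMap.range_eq_top.2 hsurj, finrank_top] at h5
    simp only [Module.finrank_prod, Module.finrank_self, Module.finrank_fin_fun] at h5
    change _ + Module.finrank ℝ Φ'.ker = _ at h5
    omega
  refine hasCovers_level_of_regular h3 hrank hcomp.isBounded fun y hy y' hy' => ?_
  have hy1 : ρ₀ y.1 = 0 := hy.1
  have hy1' : ρ₀ y'.1 = 0 := hy'.1
  have hy2 := norm_eq_one_of_mem_chainSet hy.2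
  have hy2' := norm_eq_one_of_mem_chainSet hy'.2
  simp [hy1, hy1', hy2, hy2', chainMap_eq_zero hy.2, chainMap_eq_zero hy'.2]

end

/-! ### Convexity at the points of impact -/

section Convex

variable {E : Type*} [NormedAddCommGroup E] [InnerProductSpace ℝ E] [FiniteDimensional ℝ E]

/-- A convex body lies on one side of its tangent plane. The inequality is strict because an
interior point can be pushed slightly along the gradient without leaving the body. -/
theorem IsDispersing.inner_gradient_neg {ρ : E → ℝ} (h : IsDispersing ρ)
    (hc : Convex ℝ {z | ρ z ≤ 0}) {q p : E} (hq : ρ q = 0) (hp : ρ p < 0) :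
    ⟪gradient ρ q, p - q⟫ < 0 := by
  have hcone : ∀ y, ρ y ≤ 0 → ⟪gradient ρ q, y - q⟫ ≤ 0 := by
    intro y hy
    have hmax : IsLocalMaxOn ρ {z | ρ z ≤ 0} q :=
      IsMaxOn.localize fun z hz => by rw [mem_ofPred_eq, hq]; exact hz
    exact hmax.hasFDerivWithinAt_nonpos (h.hasStrictFDerivAt q).hasFDerivAt.hasFDerivWithinAt
      (sub_mem_posTangentConeAt_of_segment_subset (hc.segment_subset hq.le hy))
  have hg := h.gradient_ne_zero q hq
  have hev : ∀ᶠ ε : ℝ in nhdsWithin 0 (Ioi 0), ρ (p + ε • gradient ρ q) < 0 := by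
    have hcont : Continuous fun ε : ℝ => ρ (p + ε • gradient ρ q) :=
      h.contDiff.continuous.comp (by fun_prop)
    refine (hcont.tendsto' 0 (ρ p) (by simp)).eventually (gt_mem_nhds hp) |>.filter_mono
      nhdsWithin_le_nhds
  obtain ⟨ε, hε, hε0⟩ := (hev.and self_mem_nhdsWithin).exists
  have h1 := hcone _ hε.le
  rw [add_sub_right_comm, inner_add_right, inner_smul_right] at h1
  have h2 : 0 < ε * ⟪gradient ρ q, gradient ρ q⟫ := mul_pos hε0 (real_inner_self_pos.2 hg)
  linarith

/-- If `ρ` were nonnegative along the flight, its endpoint would be a minimum on the segment,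
contradicting the sign of the derivative there. -/
theorem IsDispersing.exists_neg_of_inner_pos {ρ : E → ℝ} (h : IsDispersing ρ) {q v : E} {t : ℝ}
    (ht : 0 < t) (hq : ρ (q + t • v) = 0) (hv : 0 < ⟪gradient ρ (q + t • v), v⟫) :
    ∃ s ∈ Icc 0 t, ρ (q + s • v) < 0 := by
  by_contra! hcon
  have hmin : IsLocalMinOn ρ (segment ℝ (q + t • v) q) (q + t • v) := by
    refine IsMinOn.localize fun z hz => ?_
    rw [mem_ofPred_eq, hq]
    rw [segment_symm, segment_eq_image'] at hz
    obtain ⟨θ, hθ, rfl⟩ := hz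
    have := hcon (θ * t) ⟨mul_nonneg hθ.1 ht.le, mul_le_of_le_one_left ht.le hθ.2⟩
    simpa [mul_smul] using this
  have h1 := hmin.hasFDerivWithinAt_nonneg
    (h.hasStrictFDerivAt (q + t • v)).hasFDerivAt.hasFDerivWithinAt
    (sub_mem_posTangentConeAt_of_segment_subset subset_rfl)
  have h2 : q - (q + t • v) = -(t • v) := by abel
  rw [h2, innerSL_apply_apply, inner_neg_right, inner_smul_right] at h1
  have := mul_pos ht hv
  linarith

end Convex

/-! ### Unfolding the billiard to the universal cover -/

namespace Scatterers

variable {d K : ℕ} {Λ : Submodule ℤ (Space d)} (B : Scatterers Λ K)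

theorem coe_eq_coe {z w : Space d} : (z : Torus Λ) = (w : Torus Λ) ↔ z - w ∈ Λ := by
  rw [eq_comm, QuotientAddGroup.eq, sub_eq_neg_add]
  rfl

/-- The defining function of the lift of a scatterer shifted by a vector. -/
def lift (p : Fin K × Space d) (z : Space d) : ℝ := B.R p.1 (z - p.2)

theorem gradient_lift (p : Fin K × Space d) (z : Space d) :
    gradient (B.lift p) z = gradient (B.R p.1) (z - p.2) := by
  unfold gradient lift
  rw [fderiv_comp_sub]

theorem isDispersing_lift (hd : 2 ≤ d) (p : Fin K × Space d) : IsDispersing (B.lift p) where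
  contDiff := by
    have h : ContDiff ℝ 2 (B.R p.1) := (B.contDiff p.1).of_le (by
      have : 2 ≤ 8 * d - 7 := by omega
      exact_mod_cast this)
    exact h.comp (contDiff_id.sub contDiff_const)
  gradient_ne_zero z hz := by
    rw [gradient_lift]
    exact B.gradient_ne_zero _ _ hz
  curvature_pos z hz w hw hgw := by
    rw [gradient_lift] at hgw
    have h1 : fderiv ℝ (B.lift p) = fun z => fderiv ℝ (B.R p.1) (z - p.2) := by
      funext z
      exact fderiv_comp_sub _
    rw [h1, fderiv_comp_sub]
    exact B.curvature_pos _ _ hz w hw hgw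

theorem isDispersing (hd : 2 ≤ d) (i : Fin K) : IsDispersing (B.R i) := by
  have h : B.lift (i, 0) = B.R i := by
    funext z
    simp [lift]
  exact h ▸ B.isDispersing_lift hd (i, 0)

theorem convex_lift (p : Fin K × Space d) : Convex ℝ {z | B.lift p z ≤ 0} := by
  have := (B.convex p.1).translate_preimage_right (-p.2)
  have h : {z | B.lift p z ≤ 0} = (fun x => -p.2 + x) ⁻¹' {z | B.R p.1 z ≤ 0} := by
    ext z
    change B.R p.1 (z - p.2) ≤ 0 ↔ B.R p.1 (-p.2 + z) ≤ 0
    rw [neg_add_eq_sub]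
  rwa [h]

theorem isCompact_zero (hd : 2 ≤ d) (i : Fin K) : IsCompact {z | B.R i z = 0} :=
  (B.isCompact i).of_isClosed_subset
    (isClosed_eq (B.isDispersing hd i).contDiff.continuous continuous_const) fun _ hz => hz.le

theorem exists_lift_eq_zero {y : Space d} (hy : (y : Torus Λ) ∈ B.boundary) :
    ∃ p : Fin K × Space d, p.2 ∈ Λ ∧ B.lift p y = 0 := by
  obtain ⟨i, z, hz, hzy⟩ := hy
  refine ⟨(i, y - z), coe_eq_coe.1 hzy.symm, ?_⟩
  simpa [lift] using hz

theorem coe_sub_lattice {y a : Space d} (ha : a ∈ Λ) :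
    ((y - a : Space d) : Torus Λ) = (y : Torus Λ) :=
  coe_eq_coe.2 (by simpa using ha)

theorem mem_boundary_of_lift {y : Space d} {p : Fin K × Space d} (hp : p.2 ∈ Λ)
    (hy : B.lift p y = 0) : (y : Torus Λ) ∈ B.boundary :=
  ⟨p.1, y - p.2, hy, coe_sub_lattice hp⟩

theorem normal_of_lift {y : Space d} {p : Fin K × Space d} (hp : p.2 ∈ Λ)
    (hy : B.lift p y = 0) :
    B.normal (y : Torus Λ) = ‖gradient (B.lift p) y‖⁻¹ • gradient (B.lift p) y := by
  rw [gradient_lift, ← coe_sub_lattice hp, B.normal_coe hy]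

theorem reflect_of_lift (hd : 2 ≤ d) {y : Space d} {p : Fin K × Space d} (hp : p.2 ∈ Λ)
    (hy : B.lift p y = 0) (v : sphere (0 : Space d) 1) :
    (B.reflect (y : Torus Λ) v : Space d) = mirror (gradient (B.lift p) y) v := by
  have hg := (B.isDispersing_lift hd p).gradient_ne_zero y hy
  have hg' : ‖gradient (B.lift p) y‖ ≠ 0 := norm_ne_zero_iff.2 hg
  simp only [reflect, Submodule.reflection_orthogonal_apply, Submodule.reflection_singleton_apply,
    B.normal_of_lift hp hy, mirror, real_inner_smul_left, norm_smul, norm_inv, norm_norm,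
    real_inner_self_eq_norm_sq]
  rw [inv_mul_cancel₀ hg', neg_sub, smul_smul, ← Nat.cast_smul_eq_nsmul ℝ, smul_smul]
  congr 2
  simp
  field_simp

/-- At the first hit the velocity does not point out of the scatterer. -/
theorem inner_nonpos_of_first_hit (hd : 2 ≤ d) {q : Space d} {v : sphere (0 : Space d) 1}
    (hx : ((q : Torus Λ), v) ∈ B.bdryM) {t : ℝ} (ht : 0 < t)
    (hmin : ∀ s ∈ B.hitTimes ((q : Torus Λ), v), t ≤ s) {p : Fin K × Space d} (hp : p.2 ∈ Λ)
    (hq : B.lift p (q + t • (v : Space d)) = 0) :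
    ⟪gradient (B.lift p) (q + t • (v : Space d)), (v : Space d)⟫ ≤ 0 := by
  by_contra! hpos
  have hD := B.isDispersing_lift hd p
  obtain ⟨s, hs, hneg⟩ := hD.exists_neg_of_inner_pos ht hq hpos
  have hst : s < t := lt_of_le_of_ne hs.2 fun h => by rw [h, hq] at hneg; exact hneg.false
  have hcont : Continuous fun s : ℝ => B.lift p (q + s • (v : Space d)) :=
    hD.contDiff.continuous.comp (by fun_prop)
  rcases lt_trichotomy (B.lift p q) 0 with h0 | h0 | h0
  -- Three positions of the starting point: inside the body is excluded by disjointness; on its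
  -- boundary, convexity contradicts the outgoing velocity; outside, the line would have to enter
  -- the body at an earlier hit.
  · obtain ⟨i, z, hz, hzq⟩ := hx.1
    have hmem : (q - p.2) - z ∈ Λ := by
      rw [sub_right_comm]
      exact sub_mem (coe_eq_coe.1 hzq.symm) hp
    obtain ⟨h1, h2⟩ := B.disjoint p.1 i (q - p.2) z h0.le hz.le hmem
    rw [← h1, ← h2] at hz
    exact h0.ne hz
  · have h1 := hD.inner_gradient_neg (B.convex_lift p) h0 hneg
    rw [add_sub_cancel_left, inner_smul_right] at h1
    have h2 := hx.2
    simp only [B.normal_of_lift hp h0] at h2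
    rw [inner_smul_right, real_inner_comm] at h2
    have h3 : 0 < ‖gradient (B.lift p) q‖⁻¹ :=
      inv_pos.2 (norm_pos_iff.2 (hD.gradient_ne_zero q h0))
    have h4 := (mul_nonneg_iff_of_pos_left h3).1 h2
    have := mul_nonneg hs.1 h4
    linarith
  · have hmem : (0 : ℝ) ∈ Icc (B.lift p (q + s • (v : Space d)))
        (B.lift p (q + (0 : ℝ) • (v : Space d))) := ⟨hneg.le, by simpa using h0.le⟩
    obtain ⟨r, hr, hr0⟩ := intermediate_value_Icc' hs.1 hcont.continuousOn hmem
    have hr1 : 0 < r := lt_of_le_of_ne hr.1 fun h => by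
      rw [← h] at hr0
      simp only [zero_smul, add_zero] at hr0
      exact h0.ne' hr0
    have := hmin r ⟨hr1, B.mem_boundary_of_lift hp hr0⟩
    linarith [hr.2]

theorem exists_norm_bound (hd : 2 ≤ d) : ∃ D : ℝ, ∀ i z, B.R i z = 0 → ‖z‖ ≤ D := by
  have h : Bornology.IsBounded (⋃ i, {z | B.R i z = 0}) :=
    (Bornology.isBounded_iUnion).2 fun i => (B.isCompact_zero hd i).isBounded
  obtain ⟨D, hD⟩ := h.exists_norm_le
  exact ⟨D, fun i z hz => hD z (mem_iUnion.2 ⟨i, hz⟩)⟩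

theorem dist_coe_le (z w : Space d) : dist (z : Torus Λ) (w : Torus Λ) ≤ dist z w := by
  rw [dist_eq_norm, dist_eq_norm, ← QuotientAddGroup.mk_sub]
  exact QuotientAddGroup.norm_mk_le_norm

variable [DiscreteTopology Λ]

theorem isClosed_lattice : IsClosed (Λ.toAddSubgroup : Set (Space d)) := by
  have : DiscreteTopology Λ.toAddSubgroup := ‹DiscreteTopology Λ›
  exact AddSubgroup.isClosed_of_discrete

theorem isClosed_boundary (hd : 2 ≤ d) : IsClosed B.boundary := by
  have h : B.boundary = ⋃ i, (fun z : Space d => (z : Torus Λ)) '' {z | B.R i z = 0} := by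
    ext q
    simp [boundary]
  rw [h]
  have := isClosed_lattice (Λ := Λ)
  exact isClosed_iUnion_of_finite fun i =>
    IsCompact.isClosed (X := Torus Λ) ((B.isCompact_zero hd i).image continuous_quotient_mk')

/-- One step of the billiard map, described in the universal cover. -/
theorem exists_step (hd : 2 ≤ d) {τ L : ℝ} (hτ0 : 0 < τ)
    (hτ : ∀ x ∈ B.bdryM, ∀ t ∈ B.hitTimes x, τ ≤ t)
    (hL : ∀ x ∈ B.bdryM, ∃ t ∈ B.hitTimes x, t ≤ L) {q : Space d} {v : sphere (0 : Space d) 1}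
    (hx : ((q : Torus Λ), v) ∈ B.bdryM) :
    ∃ (p : Fin K × Space d) (t : ℝ) (v' : sphere (0 : Space d) 1), p.2 ∈ Λ ∧ t ∈ Icc τ L ∧
      B.lift p (q + t • (v : Space d)) = 0 ∧
      ⟪gradient (B.lift p) (q + t • (v : Space d)), (v : Space d)⟫ ≤ 0 ∧
      B.billiardMap ((q : Torus Λ), v) = (((q + t • (v : Space d) : Space d) : Torus Λ), v') ∧
      (v' : Space d) = mirror (gradient (B.lift p) (q + t • (v : Space d))) v ∧
      B.billiardMap ((q : Torus Λ), v) ∈ B.bdryM := by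
  set x : Phase Λ := ((q : Torus Λ), v) with hxdef
  have hbdd : BddBelow (B.hitTimes x) := ⟨τ, fun t ht => hτ x hx t ht⟩
  have hclosed : IsClosed (B.hitTimes x) := by
    -- The lower bound on flight times replaces the open condition `0 < t` by a closed one, so the
    -- infimum is attained.
    have h : B.hitTimes x = Ici τ ∩
        (fun t : ℝ => ((q + t • (v : Space d) : Space d) : Torus Λ)) ⁻¹' B.boundary := by
      ext t
      exact ⟨fun ht => ⟨hτ x hx t ht, ht.2⟩, fun ht => ⟨hτ0.trans_le ht.1, ht.2⟩⟩
    rw [h]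
    refine isClosed_Ici.inter ((B.isClosed_boundary hd).preimage ?_)
    exact continuous_quotient_mk'.comp (by fun_prop)
  obtain ⟨t', ht', ht'L⟩ := hL x hx
  set t := sInf (B.hitTimes x) with ht
  have htmem : t ∈ B.hitTimes x := hclosed.csInf_mem ⟨t', ht'⟩ hbdd
  obtain ⟨p, hp, hp0⟩ := B.exists_lift_eq_zero (y := q + t • (v : Space d)) htmem.2
  have hin := B.inner_nonpos_of_first_hit hd hx htmem.1 (fun s hs => csInf_le hbdd hs) hp hp0
  have hg := (B.isDispersing_lift hd p).gradient_ne_zero _ hp0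
  have hmap : B.billiardMap x = (((q + t • (v : Space d) : Space d) : Torus Λ),
      B.reflect ((q + t • (v : Space d) : Space d) : Torus Λ) v) := rfl
  refine ⟨p, t, _, hp, ⟨hτ x hx t htmem, (csInf_le hbdd ht').trans ht'L⟩, hp0, hin, hmap,
    B.reflect_of_lift hd hp hp0 v, ?_⟩
  rw [hmap]
  refine ⟨htmem.2, ?_⟩
  rw [B.reflect_of_lift hd hp hp0, B.normal_of_lift hp hp0, inner_smul_right, real_inner_comm,
    inner_mirror_left hg]
  exact mul_nonneg (inv_nonneg.2 (norm_nonneg _)) (by linarith)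

/-- The trajectory up to a tangency lifts to a sequence of collisions. -/
theorem exists_chain (hd : 2 ≤ d) {τ L : ℝ} (hτ0 : 0 < τ)
    (hτ : ∀ x ∈ B.bdryM, ∀ t ∈ B.hitTimes x, τ ≤ t)
    (hL : ∀ x ∈ B.bdryM, ∃ t ∈ B.hitTimes x, t ≤ L) {D : ℝ}
    (hD : ∀ i z, B.R i z = 0 → ‖z‖ ≤ D) : ∀ (n : ℕ) {q : Space d} {v : sphere (0 : Space d) 1}
    {r : ℝ} (_ : ‖q‖ ≤ r) (_ : ((q : Torus Λ), v) ∈ B.bdryM)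
    (_ : B.billiardMap^[n + 1] ((q : Torus Λ), v) ∈ B.tangential),
    ∃ ι : Fin (n + 1) → Fin K × Space d,
      (∀ j, (ι j).2 ∈ Λ ∧ ‖(ι j).2‖ ≤ r + (n + 1) * L + D) ∧
      ∃ t, (q, (v : Space d), t) ∈ chainSet τ L n fun j => B.lift (ι j) := by
  intro n
  induction n with
  | zero =>
    intro q v r hr hx hT
    obtain ⟨p, t, v', hp, ht, hp0, hin, hmap, hv', hmem⟩ := B.exists_step hd hτ0 hτ hL hx
    have hg := (B.isDispersing_lift hd p).gradient_ne_zero _ hp0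
    refine ⟨fun _ => p, fun _ => ⟨hp, ?_⟩, fun _ => t, ht, by simp, hp0, ?_⟩
    · have h1 := hD p.1 _ hp0
      have h2 : p.2 = q + t • (v : Space d) - (q + t • (v : Space d) - p.2) := by abel
      have h3 : ‖t • (v : Space d)‖ ≤ L := by
        rw [norm_smul, norm_eq_of_mem_sphere, mul_one, Real.norm_of_nonneg (hτ0.le.trans ht.1)]
        exact ht.2
      calc ‖p.2‖ ≤ ‖q + t • (v : Space d)‖ + ‖q + t • (v : Space d) - p.2‖ := by
            conv_lhs => rw [h2]
            exact norm_sub_le _ _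
        _ ≤ r + ((0 : ℕ) + 1) * L + D := by
            push_cast
            linarith [norm_add_le q (t • (v : Space d))]
    · rw [zero_add, Function.iterate_one, hmap] at hT
      have h := hT.2
      simp only [B.normal_of_lift hp hp0, hv'] at h
      rw [inner_smul_right, real_inner_comm, inner_mirror_left hg] at h
      simpa [hg] using h
  | succ n ih =>
    intro q v r hr hx hT
    obtain ⟨p, t, v', hp, ht, hp0, hin, hmap, hv', hmem⟩ := B.exists_step hd hτ0 hτ hL hx
    have hL0 : 0 ≤ L := hτ0.le.trans (ht.1.trans ht.2)
    have h3 : ‖t • (v : Space d)‖ ≤ L := by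
      rw [norm_smul, norm_eq_of_mem_sphere, mul_one, Real.norm_of_nonneg (hτ0.le.trans ht.1)]
      exact ht.2
    have h4 : ‖q + t • (v : Space d)‖ ≤ r + L := by
      linarith [norm_add_le q (t • (v : Space d))]
    rw [Function.iterate_succ_apply, hmap] at hT
    rw [hmap] at hmem
    obtain ⟨ι, hι, s, hs⟩ := ih h4 hmem hT
    refine ⟨Fin.cons p ι, fun j => ?_, Fin.cons t s, ⟨ht, by simp, hp0, hin⟩, ?_⟩
    · refine Fin.cases ⟨hp, ?_⟩ (fun j => ?_) j
      · have h1 := hD p.1 _ hp0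
        have h2 : p.2 = q + t • (v : Space d) - (q + t • (v : Space d) - p.2) := by abel
        have h5 : ‖p.2‖ ≤ ‖q + t • (v : Space d)‖ + ‖q + t • (v : Space d) - p.2‖ := by
          conv_lhs => rw [h2]
          exact norm_sub_le _ _
        have : 0 ≤ (n : ℝ) * L := by positivity
        simp only [Fin.cons_zero]
        push_cast
        linarith
      · refine ⟨(hι j).1, (hι j).2.trans (le_of_eq ?_)⟩
        push_cast
        ring
    · rw [hv'] at hs
      exact hs

/-- Makes the number of itineraries of a given length finite, and later the number of lifts of a
small ball meeting a scatterer. -/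
theorem finite_lattice_le (r : ℝ) : {a : Space d | a ∈ Λ ∧ ‖a‖ ≤ r}.Finite := by
  have h := Metric.finite_isBounded_inter_isClosed (s := (Λ : Set (Space d)))
    (K := closedBall 0 r) DiscreteTopology.isDiscrete isBounded_closedBall
    (isClosed_lattice (Λ := Λ))
  refine h.subset fun a ha => ⟨?_, ha.1⟩
  simpa using ha.2

/-- The singularity set `T⁻ᵏ S` has coverings of size `δ^{-(2d-3)}`. -/
theorem hasCovers_singular (hd : 2 ≤ d) (hhorizon : B.FiniteHorizon)
    (hflight : B.FlightTimeBoundedBelow) (n : ℕ) : HasCovers (2 * d - 3) (B.singular (n + 1)) := by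
  obtain ⟨L, hL⟩ := hhorizon
  obtain ⟨τ, hτ0, hτ⟩ := hflight
  obtain ⟨D, hD⟩ := B.exists_norm_bound hd
  let I : Set (Fin (n + 1) → Fin K × Space d) :=
    {ι | ∀ j, ι j ∈ (univ : Set (Fin K)) ×ˢ {a : Space d | a ∈ Λ ∧ ‖a‖ ≤ D + (n + 1) * L + D}}
  have hI : I.Finite := Set.Finite.pi' fun _ => finite_univ.prod (finite_lattice_le _)
  let Z : Fin K → (Fin (n + 1) → Fin K × Space d) → Set (Space d × Space d × (Fin (n + 1) → ℝ)) :=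
    fun i ι => {x | B.R i x.1 = 0} ∩ chainSet τ L n fun j => B.lift (ι j)
  let A : Fin K → (Fin (n + 1) → Fin K × Space d) → Set (Phase Λ) :=
    fun i ι => {x | ∃ y ∈ Z i ι, (y.1 : Torus Λ) = x.1 ∧ y.2.1 = x.2}
  have hsub : B.singular (n + 1) ⊆ ⋃ i ∈ (univ : Set (Fin K)), ⋃ ι ∈ I, A i ι := by
    rintro ⟨q, v⟩ ⟨hx, hT⟩
    obtain ⟨i, z, hz, rfl⟩ := hx.1
    obtain ⟨ι, hι, t, ht⟩ := B.exists_chain hd hτ0 hτ hL hD n (hD i z hz) hx hT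
    refine mem_iUnion₂.2 ⟨i, mem_univ _, mem_iUnion₂.2 ⟨ι, fun j => ⟨mem_univ _, hι j⟩, ?_⟩⟩
    exact ⟨_, ⟨hz, ht⟩, rfl, rfl⟩
  refine HasCovers.mono (HasCovers.biUnion finite_univ fun i _ => HasCovers.biUnion hI
    fun ι _ => ?_) hsub
  have hZ : HasCovers (2 * d - 3) (Z i ι) := by
    have := hasCovers_chainSet hτ0 (B.isDispersing hd i) (fun j => B.isDispersing_lift hd (ι j))
      (B.isCompact_zero hd i) (b := L) (by simpa using hd)
    simpa using this
  refine hZ.of_relation (fun y x => (y.1 : Torus Λ) = x.1 ∧ y.2.1 = x.2) zero_le_one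
    (fun x hx => hx) ?_
  rintro y - y' - ⟨x1, x2⟩ ⟨x1', x2'⟩ ⟨rfl, h2⟩ ⟨rfl, h2'⟩
  simp only [one_mul, Prod.dist_eq] at *
  refine max_le ((dist_coe_le _ _).trans (le_max_left _ _)) ?_
  rw [Subtype.dist_eq, ← h2, ← h2']
  exact (le_max_left _ _).trans (le_max_right _ _)

end Scatterers

/-! ### From coverings to measures: growth of balls -/

/-- The measure of the `δ`-neighbourhood of a set of dimension `m`, for a measure of dimension
`m + 1`. -/
theorem HasCovers.measure_thickening_le {M : Type*} [PseudoMetricSpace M] [MeasurableSpace M]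
    {ν : Measure M} {m : ℕ} {A : Set M} (hA : HasCovers m A) {C : ℝ} (hC : 0 ≤ C)
    (hν : ∀ x r, 0 < r → r ≤ 1 → ν (ball x r) ≤ ENNReal.ofReal (C * r ^ (m + 1))) :
    ∃ C' : ℝ, ∀ δ, 0 < δ → δ < 1 / 2 → ν (thickening δ A) ≤ ENNReal.ofReal (C' * δ) := by
  classical
  obtain ⟨N, hN⟩ := hA
  refine ⟨N * (C * 2 ^ (m + 1)), fun δ h0 h1 => ?_⟩
  obtain ⟨T, hT, hcov, hdiam⟩ := hN δ h0 (by linarith)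
  -- Diameter `δ` plus thickening `δ` fits in radius `2 * δ`, which stays below 1 as `δ < 1 / 2`.
  let b : Set M → Set M := fun t => if h : t.Nonempty then ball h.some (2 * δ) else ∅
  have hb : ∀ t, ν (b t) ≤ ENNReal.ofReal (C * (2 * δ) ^ (m + 1)) := by
    intro t
    by_cases h : t.Nonempty
    · simp only [b, dif_pos h]
      exact hν _ _ (by positivity) (by linarith)
    · simp [b, dif_neg h]
  have hsub : thickening δ A ⊆ ⋃ t ∈ T, b t := by
    intro x hx
    obtain ⟨a, ha, hxa⟩ := mem_thickening_iff.1 hx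
    obtain ⟨t, ht, hat⟩ := mem_iUnion₂.1 (hcov ha)
    have h : t.Nonempty := ⟨a, hat⟩
    refine mem_iUnion₂.2 ⟨t, ht, ?_⟩
    simp only [b, dif_pos h, mem_ball]
    linarith [dist_triangle x a h.some, hdiam t ht a hat _ h.some_mem]
  calc ν (thickening δ A) ≤ ∑ t ∈ T, ν (b t) :=
        (measure_mono hsub).trans (measure_biUnion_finset_le _ _)
    _ ≤ ∑ t ∈ T, ENNReal.ofReal (C * (2 * δ) ^ (m + 1)) := Finset.sum_le_sum fun t _ => hb t
    _ = ENNReal.ofReal (T.card * (C * (2 * δ) ^ (m + 1))) := by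
        rw [Finset.sum_const, nsmul_eq_mul, ENNReal.ofReal_mul (Nat.cast_nonneg _),
          ENNReal.ofReal_natCast]
    _ ≤ ENNReal.ofReal (N * (C * 2 ^ (m + 1)) * δ) := by
        refine ENNReal.ofReal_le_ofReal ?_
        calc (T.card : ℝ) * (C * (2 * δ) ^ (m + 1))
            = T.card * δ ^ m * (C * 2 ^ (m + 1) * δ) := by ring
          _ ≤ N * (C * 2 ^ (m + 1) * δ) := by gcongr
          _ = N * (C * 2 ^ (m + 1)) * δ := by ring

open scoped Pointwise in
/-- Growth of the surface measure of the sphere. -/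
theorem exists_toSphere_ball_le {E : Type*} [NormedAddCommGroup E] [NormedSpace ℝ E]
    [FiniteDimensional ℝ E] [MeasurableSpace E] [BorelSpace E] (μ : Measure E)
    [μ.IsAddHaarMeasure] {m : ℕ} (hm : Module.finrank ℝ E = m + 1) :
    ∃ C : ℝ, 0 ≤ C ∧ ∀ (v : sphere (0 : E) 1) (r : ℝ), 0 < r → r ≤ 1 →
      μ.toSphere (ball v r) ≤ ENNReal.ofReal (C * r ^ m) := by
  have : Nontrivial E := Module.nontrivial_of_finrank_pos (R := ℝ) (by omega)
  have hfin : μ (ball 0 1) ≠ ⊤ := measure_ball_lt_top.ne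
  set c := (μ (ball 0 1)).toReal with hc
  refine ⟨(m + 1) * (2 * 2 ^ (m + 1) * c), by positivity, fun v r h0 h1 => ?_⟩
  rw [μ.toSphere_apply' measurableSet_ball, hm]
  set N := ⌊1 / r⌋₊ + 1 with hN
  -- The spherical measure is a multiple of the volume of the cone over the cap. About `1 / r` balls
  -- of radius `2 * r`, centred along the ray through `v`, cover this cone, so one power of `r` is
  -- lost.
  have hsub : Ioo (0 : ℝ) 1 • ((↑) '' ball v r : Set E) ⊆
      ⋃ j ∈ Finset.range N, ball (((j : ℝ) * r) • (v : E)) (2 * r) := by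
    rintro _ ⟨ρ, hρ, _, ⟨u, hu, rfl⟩, rfl⟩
    have h2 : ‖(v : E)‖ = 1 := norm_eq_of_mem_sphere v
    have h3 : ‖(u : E) - v‖ < r := by rw [← dist_eq_norm]; exact hu
    have hfl : ⌊ρ / r⌋₊ ≤ ρ / r := Nat.floor_le (div_nonneg hρ.1.le h0.le)
    have hlt : ρ / r < ⌊ρ / r⌋₊ + 1 := Nat.lt_floor_add_one _
    rw [le_div_iff₀ h0] at hfl
    rw [div_lt_iff₀ h0] at hlt
    refine mem_iUnion₂.2 ⟨⌊ρ / r⌋₊, ?_, ?_⟩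
    · rw [Finset.mem_range, hN, Nat.lt_succ_iff]
      exact Nat.floor_le_floor (by gcongr; exact hρ.2.le)
    · simp only [mem_ball, dist_eq_norm]
      have h4 : ρ • (u : E) - ((⌊ρ / r⌋₊ : ℝ) * r) • (v : E)
          = ρ • ((u : E) - v) + (ρ - ⌊ρ / r⌋₊ * r) • (v : E) := by module
      rw [h4]
      calc _ ≤ ‖ρ • ((u : E) - v)‖ + ‖(ρ - ⌊ρ / r⌋₊ * r) • (v : E)‖ := norm_add_le _ _
        _ = ρ * ‖(u : E) - v‖ + (ρ - ⌊ρ / r⌋₊ * r) := by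
          rw [norm_smul, norm_smul, h2, mul_one, Real.norm_of_nonneg hρ.1.le,
            Real.norm_of_nonneg (by linarith)]
        _ < 2 * r := by nlinarith [norm_nonneg ((u : E) - v), hρ.1, hρ.2]
  have hball : ∀ x : E, μ (ball x (2 * r)) = ENNReal.ofReal ((2 * r) ^ (m + 1) * c) := by
    intro x
    rw [μ.addHaar_ball x (by positivity), hm, ENNReal.ofReal_mul (by positivity), hc,
      ENNReal.ofReal_toReal hfin]
  calc ((m + 1 : ℕ) : ENNReal) * μ (Ioo (0 : ℝ) 1 • ((↑) '' ball v r : Set E))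
      ≤ ((m + 1 : ℕ) : ENNReal) *
          ∑ j ∈ Finset.range N, μ (ball (((j : ℝ) * r) • (v : E)) (2 * r)) := by
        gcongr
        exact (measure_mono hsub).trans (measure_biUnion_finset_le _ _)
    _ = ENNReal.ofReal ((m + 1 : ℕ) * (N * ((2 * r) ^ (m + 1) * c))) := by
        simp only [hball, Finset.sum_const, Finset.card_range, nsmul_eq_mul]
        rw [ENNReal.ofReal_mul (Nat.cast_nonneg _), ENNReal.ofReal_mul (Nat.cast_nonneg _),
          ENNReal.ofReal_natCast, ENNReal.ofReal_natCast]
    _ ≤ ENNReal.ofReal ((m + 1) * (2 * 2 ^ (m + 1) * c) * r ^ m) := by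
        refine ENNReal.ofReal_le_ofReal ?_
        have hNr : (N : ℝ) * r ≤ 2 := by
          have : (N : ℝ) ≤ 1 / r + 1 := by
            rw [hN]; push_cast; linarith [Nat.floor_le (show 0 ≤ 1 / r by positivity)]
          calc (N : ℝ) * r ≤ (1 / r + 1) * r := by gcongr
            _ = 1 + r := by field_simp
            _ ≤ 2 := by linarith
        push_cast
        calc (m + 1 : ℝ) * (N * ((2 * r) ^ (m + 1) * c))
            = (m + 1) * ((N * r) * 2 ^ (m + 1) * c) * r ^ m := by ring
          _ ≤ (m + 1) * (2 * 2 ^ (m + 1) * c) * r ^ m := by gcongr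

/-- Growth of the Hausdorff measure of a compact dispersing hypersurface. -/
theorem IsDispersing.exists_hausdorffMeasure_ball_le {E : Type*} [NormedAddCommGroup E]
    [InnerProductSpace ℝ E] [FiniteDimensional ℝ E] [MeasurableSpace E] [BorelSpace E]
    {ρ : E → ℝ} (h : IsDispersing ρ) (hc : IsCompact {z | ρ z = 0}) {m : ℕ}
    (hm : Module.finrank ℝ E = m + 1) :
    ∃ C : ℝ, 0 ≤ C ∧ ∀ (z : E) (r : ℝ), 0 < r →
      μH[(m : ℝ)] ({z | ρ z = 0} ∩ ball z r) ≤ ENNReal.ofReal (C * r ^ m) := by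
  set S := {z | ρ z = 0} with hS
  have key : ∃ C : ℝ, 0 ≤ C ∧ ∀ (z : E) (r : ℝ), 0 < r →
      μH[(m : ℝ)] (S ∩ S ∩ ball z r) ≤ ENNReal.ofReal (C * r ^ m) := by
    refine hc.induction_on (p := fun s => ∃ C : ℝ, 0 ≤ C ∧ ∀ (z : E) (r : ℝ), 0 < r →
      μH[(m : ℝ)] (S ∩ s ∩ ball z r) ≤ ENNReal.ofReal (C * r ^ m)) ?_ ?_ ?_ ?_
    · exact ⟨0, le_rfl, by simp⟩
    · rintro s t hst ⟨C, hC, h⟩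
      exact ⟨C, hC, fun z r hr => (measure_mono (by gcongr)).trans (h z r hr)⟩
    · rintro s t ⟨C, hC, h⟩ ⟨C', hC', h'⟩
      refine ⟨C + C', by positivity, fun z r hr => ?_⟩
      rw [inter_union_distrib_left, union_inter_distrib_right, add_mul,
        ENNReal.ofReal_add (by positivity) (by positivity)]
      exact (measure_union_le _ _).trans (add_le_add (h z r hr) (h' z r hr))
    · intro x hx
      have hg := h.gradient_ne_zero x hx
      -- A nonzero gradient makes the kernel a hyperplane, of dimension `m`.
      have hsurj : Function.Surjective (innerSL ℝ (gradient ρ x)) := by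
        intro s
        refine ⟨(s * ⟪gradient ρ x, gradient ρ x⟫⁻¹) • gradient ρ x, ?_⟩
        rw [innerSL_apply_apply, inner_smul_right, mul_assoc,
          inv_mul_cancel₀ (inner_self_ne_zero_of_ne hg), mul_one]
      have hrank : Module.finrank ℝ (innerSL ℝ (gradient ρ x)).ker = m := by
        have h5 := LinearMap.finrank_range_add_finrank_ker (innerSL ℝ (gradient ρ x)).toLinearMap
        rw [LinearMap.range_eq_top.2 hsurj, finrank_top, Module.finrank_self, hm] at h5
        change _ + Module.finrank ℝ (innerSL ℝ (gradient ρ x)).ker = _ at h5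
        omega
      obtain ⟨W, hW, C, hC⟩ := hausdorffMeasure_level_of_regular (h.hasStrictFDerivAt x) hrank
        (A := S) fun y hy y' hy' => hy.trans hy'.symm
      refine ⟨W, mem_nhdsWithin_of_mem_nhds hW, |C|, abs_nonneg C, fun z r hr => ?_⟩
      refine (hC z r hr).trans (ENNReal.ofReal_le_ofReal ?_)
      gcongr
      exact le_abs_self C
  simpa only [inter_self] using key

namespace Scatterers

variable {d K : ℕ} {Λ : Submodule ℤ (Space d)} (B : Scatterers Λ K)

theorem exists_uniform_hausdorffMeasure_ball_le (hd : 2 ≤ d) : ∃ C : ℝ, 0 ≤ C ∧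
    ∀ (i : Fin K) (z : Space d) (r : ℝ), 0 < r →
      μH[(d : ℝ) - 1] ({z | B.R i z = 0} ∩ ball z r) ≤ ENNReal.ofReal (C * r ^ (d - 1)) := by
  have hcast : (d : ℝ) - 1 = ((d - 1 : ℕ) : ℝ) := by
    rw [Nat.cast_sub (by omega)]; simp
  have hm : Module.finrank ℝ (Space d) = (d - 1) + 1 := by
    rw [finrank_euclideanSpace_fin]; omega
  have h := fun i => (B.isDispersing hd i).exists_hausdorffMeasure_ball_le
    (B.isCompact_zero hd i) hm
  choose C hC0 hC using h
  refine ⟨∑ i, C i, Finset.sum_nonneg fun i _ => hC0 i, fun i z r hr => ?_⟩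
  rw [hcast]
  refine (hC i z r hr).trans (ENNReal.ofReal_le_ofReal ?_)
  gcongr
  exact Finset.single_le_sum (fun j _ => hC0 j) (Finset.mem_univ i)

theorem measurable_coe : Measurable fun z : Space d => (z : Torus Λ) :=
  fun _ h => h

theorem isFiniteMeasure_surfaceMeasure (hd : 2 ≤ d) : IsFiniteMeasure B.surfaceMeasure := by
  obtain ⟨C, -, hC⟩ := B.exists_uniform_hausdorffMeasure_ball_le hd
  obtain ⟨D, hD⟩ := B.exists_norm_bound hd
  refine ⟨?_⟩
  rw [surfaceMeasure, Measure.finsetSum_apply]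
  refine ENNReal.sum_lt_top.2 fun i _ => ?_
  rw [Measure.map_apply measurable_coe MeasurableSet.univ, preimage_univ,
    Measure.restrict_apply_univ]
  have hsub : {z | B.R i z = 0} ⊆ {z | B.R i z = 0} ∩ ball 0 (|D| + 1) := by
    refine fun z hz => ⟨hz, ?_⟩
    rw [mem_ball_zero_iff]
    linarith [hD i z hz, le_abs_self D]
  exact (measure_mono hsub).trans_lt ((hC i 0 _ (by positivity)).trans_lt ENNReal.ofReal_lt_top)

theorem norm_normal_le (q : Torus Λ) : ‖B.normal q‖ ≤ 1 := by
  unfold normal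
  split_ifs
  · rw [norm_smul, norm_inv, norm_norm]
    exact inv_mul_le_one
  · simp

theorem invMeasure_le_volumeM : B.invMeasure ≤ B.volumeM := by
  unfold invMeasure
  refine (withDensity_mono (g := 1) (Filter.Eventually.of_forall fun x => ?_)).trans
    (withDensity_one).le
  refine ENNReal.ofReal_le_one.2 ((abs_real_inner_le_norm _ _).trans ?_)
  rw [norm_eq_of_mem_sphere, one_mul]
  exact B.norm_normal_le _

variable [DiscreteTopology Λ]

/-- Growth of the surface measure on the boundary of the billiard domain. -/
theorem exists_surfaceMeasure_ball_le (hd : 2 ≤ d) : ∃ C : ℝ, 0 ≤ C ∧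
    ∀ (q : Torus Λ) (r : ℝ), 0 < r → r ≤ 1 →
      B.surfaceMeasure (ball q r) ≤ ENNReal.ofReal (C * r ^ (d - 1)) := by
  obtain ⟨C, hC0, hC⟩ := B.exists_uniform_hausdorffMeasure_ball_le hd
  obtain ⟨D, hD⟩ := B.exists_norm_bound hd
  -- Two points of one lifted scatterer differ by at most `D + D`, and their images in a ball of
  -- radius `r ≤ 1` are less than 2 apart; this bounds the lattice shift between them.
  have hfin := finite_lattice_le (Λ := Λ) (D + D + 2)
  set A := hfin.toFinset with hA
  refine ⟨K * (A.card * (C * 2 ^ (d - 1))), by positivity, fun q r h0 h1 => ?_⟩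
  have hmk : Continuous fun z : Space d => (z : Torus Λ) := continuous_quotient_mk'
  have hball : MeasurableSet (ball q r) := (isOpen_ball.preimage hmk).measurableSet
  rw [surfaceMeasure, Measure.finsetSum_apply]
  have hi : ∀ i, Measure.map (fun z : Space d => (z : Torus Λ))
      ((μH[(d : ℝ) - 1] : Measure (Space d)).restrict {z | B.R i z = 0}) (ball q r) ≤
      ENNReal.ofReal (A.card * (C * (2 * r) ^ (d - 1))) := by
    intro i
    rw [Measure.map_apply measurable_coe hball, Measure.restrict_apply (measurable_coe hball)]
    rcases ((fun z : Space d => (z : Torus Λ)) ⁻¹' ball q r ∩ {z | B.R i z = 0}).eq_empty_or_nonempty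
      with he | ⟨z, hzq, hz⟩
    · simp [he]
    have hsub : (fun z : Space d => (z : Torus Λ)) ⁻¹' ball q r ∩ {z | B.R i z = 0} ⊆
        ⋃ a ∈ A, {z | B.R i z = 0} ∩ ball (z + a) (2 * r) := by
      rintro w ⟨hwq, hw⟩
      have hdist : dist (w : Torus Λ) (z : Torus Λ) < 2 * r := by
        have h2 : dist (w : Torus Λ) q < r := hwq
        have h3 : dist (z : Torus Λ) q < r := hzq
        linarith [dist_triangle_right (w : Torus Λ) (z : Torus Λ) q]
      rw [dist_eq_norm, ← QuotientAddGroup.mk_sub, QuotientAddGroup.norm_lt_iff] at hdist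
      obtain ⟨m, hm, hmr⟩ := hdist
      have hmem : w - z - m ∈ Λ := coe_eq_coe.1 hm.symm
      refine mem_iUnion₂.2 ⟨w - z - m, ?_, hw, ?_⟩
      · rw [hA, Finite.mem_toFinset]
        refine ⟨hmem, ?_⟩
        have := norm_sub_le (w - z) m
        have := norm_sub_le w z
        have := hD i w hw
        have := hD i z hz
        linarith
      · rw [mem_ball, dist_eq_norm]
        convert hmr using 2
        abel
    calc _ ≤ ∑ a ∈ A, μH[(d : ℝ) - 1] ({z | B.R i z = 0} ∩ ball (z + a) (2 * r)) :=
          (measure_mono hsub).trans (measure_biUnion_finset_le _ _)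
      _ ≤ ∑ a ∈ A, ENNReal.ofReal (C * (2 * r) ^ (d - 1)) :=
          Finset.sum_le_sum fun a _ => hC i _ _ (by positivity)
      _ = _ := by
          rw [Finset.sum_const, nsmul_eq_mul, ENNReal.ofReal_mul (Nat.cast_nonneg _),
            ENNReal.ofReal_natCast]
  refine (Finset.sum_le_sum fun i _ => hi i).trans (le_of_eq ?_)
  rw [Finset.sum_const, nsmul_eq_mul, Finset.card_univ, Fintype.card_fin,
    ← ENNReal.ofReal_natCast K, ← ENNReal.ofReal_mul (Nat.cast_nonneg _)]
  congr 1
  ring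

/-- Growth of the Riemannian volume of the phase space. -/
theorem exists_volumeM_ball_le (hd : 2 ≤ d) : ∃ C : ℝ, 0 ≤ C ∧
    ∀ (x : Phase Λ) (r : ℝ), 0 < r → r ≤ 1 →
      B.volumeM (ball x r) ≤ ENNReal.ofReal (C * r ^ (2 * d - 3 + 1)) := by
  obtain ⟨C, hC0, hC⟩ := B.exists_surfaceMeasure_ball_le hd
  obtain ⟨C', hC0', hC'⟩ := exists_toSphere_ball_le (volume : Measure (Space d)) (m := d - 1)
    (by rw [finrank_euclideanSpace_fin]; omega)
  have := B.isFiniteMeasure_surfaceMeasure hd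
  refine ⟨C * C', by positivity, fun x r h0 h1 => ?_⟩
  rw [volumeM]
  refine (Measure.restrict_apply_le _ _).trans ?_
  rw [← ball_prod_same, Measure.prod_prod]
  refine (mul_le_mul' (hC x.1 r h0 h1) (hC' x.2 r h0 h1)).trans (le_of_eq ?_)
  rw [← ENNReal.ofReal_mul (by positivity)]
  have : 2 * d - 3 + 1 = (d - 1) + (d - 1) := by omega
  rw [this]
  congr 1
  ring

/-- A finite union of images of compact sets in the cover, where the normal is replaced by the
continuous gradient. This makes `∂M ∖ S` relatively open. -/
theorem isClosed_tangential (hd : 2 ≤ d) : IsClosed B.tangential := by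
  let S : Fin K → Set (Space d × sphere (0 : Space d) 1) := fun i =>
    ({z | B.R i z = 0} ×ˢ univ) ∩ {y | ⟪(y.2 : Space d), gradient (B.R i) y.1⟫ = 0}
  have hS : ∀ i, IsCompact (S i) := fun i => by
    refine ((B.isCompact_zero hd i).prod isCompact_univ).inter_right
      (isClosed_eq (Continuous.inner (by fun_prop) ?_) continuous_const)
    exact (B.isDispersing hd i).continuous_gradient.comp continuous_fst
  have h : B.tangential = ⋃ i, (fun y : Space d × sphere (0 : Space d) 1 =>
      ((y.1 : Torus Λ), y.2)) '' S i := by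
    ext ⟨q, v⟩
    simp only [mem_iUnion, mem_image]
    have hn : ∀ {i z}, B.R i z = 0 → (⟪(v : Space d), B.normal (z : Torus Λ)⟫ = 0 ↔
        ⟪(v : Space d), gradient (B.R i) z⟫ = 0) := by
      intro i z hz
      rw [B.normal_coe hz, inner_smul_right]
      simp [B.gradient_ne_zero i z hz]
    constructor
    · rintro ⟨⟨⟨i, z, hz, rfl⟩, -⟩, h⟩
      exact ⟨i, (z, v), ⟨⟨hz, mem_univ _⟩, (hn hz).1 h⟩, rfl⟩
    · rintro ⟨i, ⟨z, w⟩, ⟨⟨hz, -⟩, h⟩, heq⟩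
      obtain ⟨rfl, rfl⟩ := Prod.ext_iff.1 heq
      have h0 := (hn hz).2 h
      exact ⟨⟨⟨i, z, hz, rfl⟩, h0.ge⟩, h0⟩
  rw [h]
  have := isClosed_lattice (Λ := Λ)
  refine isClosed_iUnion_of_finite fun i => IsCompact.isClosed (X := Phase Λ)
    ((hS i).image ?_)
  exact (continuous_quotient_mk'.comp continuous_fst).prodMk continuous_snd

end Scatterers

end DispersingBilliard

end

theorem corollary7p2 {d : ℕ} (hd : 2 ≤ d) (Λ : Submodule ℤ (DispersingBilliard.Space d))
    [DiscreteTopology Λ] [IsZLattice ℝ Λ] {K : ℕ} (B : DispersingBilliard.Scatterers Λ K)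
    (hhorizon : B.FiniteHorizon) (hflight : B.FlightTimeBoundedBelow)
    (htangencies : B.TangenciesAtMost (2 * d - 2))
    (x₀ : DispersingBilliard.Phase Λ) (hx₀ : x₀ ∈ B.bdryM \ B.tangential) :
    ∃ U : Set (DispersingBilliard.Phase Λ),
      (∃ O : Set (DispersingBilliard.Phase Λ), IsOpen O ∧ U = O ∩ B.bdryM) ∧
      x₀ ∈ U ∧ U ⊆ B.bdryM \ B.tangential ∧
      ∀ k : ℕ, ∃ C δ₀ : ℝ, 0 < δ₀ ∧
        ∀ y ∈ B.singular k ∩ U, ∀ δ : ℝ, 0 < δ → δ < δ₀ →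
          B.volumeM (Metric.thickening δ (connectedComponentIn (B.singular k ∩ U) y) ∩ B.bdryM)
              ≤ ENNReal.ofReal (C * δ) ∧
          B.invMeasure (Metric.thickening δ (connectedComponentIn (B.singular k ∩ U) y) ∩ B.bdryM)
              ≤ ENNReal.ofReal (C * δ) := by
  refine ⟨B.bdryM \ B.tangential, ⟨B.tangentialᶜ, (B.isClosed_tangential hd).isOpen_compl,
    by rw [inter_comm]; rfl⟩, hx₀, subset_rfl, fun k => ?_⟩
  cases k with
  -- `T⁰` is the identity, and `U` avoids `S`.
  | zero => exact ⟨0, 1, one_pos, fun y hy => absurd hy.1.2 hy.2.2⟩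
  | succ n =>
    obtain ⟨C, hC0, hC⟩ := B.exists_volumeM_ball_le hd
    obtain ⟨C', hC'⟩ :=
      (B.hasCovers_singular hd hhorizon hflight n).measure_thickening_le hC0 hC
    refine ⟨C', 1 / 2, by norm_num, fun y _ δ h0 h1 => ?_⟩
    have hsub : thickening δ (connectedComponentIn (B.singular (n + 1) ∩
        (B.bdryM \ B.tangential)) y) ∩ B.bdryM ⊆ thickening δ (B.singular (n + 1)) :=
      inter_subset_left.trans (thickening_subset_of_subset δ
        ((connectedComponentIn_subset _ _).trans inter_subset_left))
    have hvol := (measure_mono hsub).trans (hC' δ h0 h1)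
    exact ⟨hvol, (B.invMeasure_le_volumeM _).trans hvol⟩
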